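/- Fix a universe. An algebraic type $V$ is a graded set of finitary operators together with, for each $n$, an equivalence relation on the $n$-ary derived operators (the equations of $V$). $V$ is self-enhancing if for all $V$-algebras $A,B$ the pointwise operations make the set $\mathrm{Hom}(A,B)$ a $V$-algebra and composition is bilinear. Let $V$ be a self-enhancing algebraic type which has a constant (nullary) operator $0$. A $W$-algebra is a commutative monoid object in $V$-algebras: a $V$-algebra $R$ with a commutative monoid structure such that $a\cdot\phi(b_1,\dots,b_n)=\phi(ab_1,\dots,ab_n)$ for every operator $\phi$ of $V$. An $R$-module is a $V$-algebra with a $V$-bilinear action of the monoid $R$; it is zero if it has exactly one element. An ideal of $R$ is an $R$-submodule of $R$. Let $\mathscr C$ be the opposite of the category of $W$-algebras, and let $\mathscr E$ be the class of localizations $S^{-1}R\to R$ (in $\mathscr C$) with $S\subset R$ a finitely generated multiplicative system. A coherent Grothendieck topology $\mathcal O$ assigns to each $R$ a family $\mathcal O_R$ of finite sets of $\mathscr E$-morphisms with target $R$ such that: 1. for every $\{U_i\to R\}_i\in\mathcal O_R$ the fork $\coprod_{i,j}U_i\times_RU_j\rightrightarrows\coprod_iU_i\to R$ is exact in $\mathscr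 C$ (a coequalizer); 2. (a) $\{R\to R\}\in\mathcal O_R$; (b) a finite set of $\mathscr E$-morphisms to $R$ containing a member of $\mathcal O_R$ is in $\mathcal O_R$; (c) for every morphism $R'\to R$ of $\mathscr C$ and $S\in\mathcal O_R$, the base change $R'\times_RS$ is in $\mathcal O_{R'}$; (d) if $S\in\mathcal O_R$, $T$ is a finite set of $\mathscr E$-morphisms to $R$, and $U\times_RT\in\mathcal O_U$ for all $[U\to R]\in S$, then $T\in\mathcal O_R$. The Zariski topology $\mathcal O^{\mathrm{Zar}}$ consists of the finite sets $\{R_{f_i}\to R\}_i$ such that the ideal generated by the $f_i$ is all of $R$. For a topology $\mathcal O$, let $\Omega_1(R)$ be the lattice of finite sets of $\mathscr E$-morphisms to $R$ modulo the equivalence associated with the preorder $\{U_i\}\prec\{V_j\}\iff\{U_i\times_RV_j\to U_i\}_j\in\mathcal O_{U_i}$ for all $i$, with join given by union and meet by $\{U_i\times_RV_j\}_{i,j}$. Let $\operatorname{Spec}^{\mathcal O}R$ be the space of lattice homomorphisms (preserving $0$ and $1$) $\Omega_1(R)\to\{0,1\}$, with the topology generated by the sets $\{p\mid p(a)=1\}$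 for $a\in\Omega_1(R)$. For an $R$-module $M$, let $\mathrm{Sh}^{\mathcal O}(M)$ be the sheaf on $\operatorname{Spec}^{\mathcal O}R$ associated with $A\mapsto A\otimes_RM$, where $A\to R$ runs over $\mathscr E$-morphisms. **Theorem.** Consider the following condition on a coherent Grothendieck topology $\mathcal O$: (*) for every $W$-algebra $R$ and every $R$-module $M$, $\mathrm{Sh}^{\mathcal O}(M)=0$ if and only if $M=0$. The Zariski topology is a coherent Grothendieck topology satisfying (*), and it is the one with the most coverings: every coherent Grothendieck topology $\mathcal O$ satisfying (*) is contained in it, i.e. $\mathcal O_R\subset\mathcal O^{\mathrm{Zar}}_R$ for all $R$. (In this sense it is the "coarsest" topology satisfying (*).) -/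

import Mathlib

open CategoryTheory Opposite TopologicalSpace
open scoped FirstOrder

universe u v w

/-! ## Finitary algebraic types and their algebras -/

/-- The purely algebraic language with operators `ops n` in arity `n`. -/
abbrev operatorLanguage (ops : ℕ → Type u) : FirstOrder.Language.{u, 0} := ⟨ops, fun _ => Empty⟩

/-- A finitary algebraic type `⟨Ω, E⟩`: a graded set of operators, and for every `n` an
equivalence relation on the set of `n`-ary derived operators, i.e. terms in `n` variables. -/
structure AlgType where
  /-- the operators of arity `n` -/
  ops : ℕ → Type u
  /-- the equational class -/
  eqns : ∀ n : ℕ, Setoid ((operatorLanguage ops).Term (Fin n))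

namespace AlgType

/-- The language of the operators of `V`. -/
abbrev lang (V : AlgType.{u}) : FirstOrder.Language.{u, 0} := operatorLanguage V.ops

/-- The operators on `A` satisfy the equations of `V`. -/
def Satisfies (V : AlgType.{u}) {A : Type w} (str : V.lang.Structure A) : Prop :=
  ∀ (n : ℕ) (s t : V.lang.Term (Fin n)), (V.eqns n).r s t →
    ∀ a : Fin n → A, FirstOrder.Language.Term.realize a s = FirstOrder.Language.Term.realize a t

/-- A `V`-algebra (in sets). -/
structure Alg (V : AlgType.{u}) where
  carrier : Type u
  [str : V.lang.Structure carrier]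
  satisfies : V.Satisfies str

instance (V : AlgType.{u}) : CoeSort V.Alg (Type u) := ⟨Alg.carrier⟩

instance (V : AlgType.{u}) (A : V.Alg) : V.lang.Structure A := A.str

/-- The natural (that is, pointwise) `V`-algebra structure on all the sets of homomorphisms between
`V`-algebras, for which composition is bilinear. -/
structure SelfEnhancement (V : AlgType.{u}) where
  /-- operators on the set of homomorphisms -/
  homStr : ∀ A B : V.Alg, V.lang.Structure (A →[V.lang] B)
  homStr_satisfies : ∀ A B : V.Alg, V.Satisfies (homStr A B)
  /-- the operators act on the values -/
  natural : ∀ (A B : V.Alg) {n : ℕ} (φ : V.ops n) (f : Fin n → (A →[V.lang] B)) (a : A),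
    (homStr A B).funMap φ f a = FirstOrder.Language.Structure.funMap (L := V.lang) φ fun i => f i a
  precomp : ∀ (A B X : V.Alg) (h : A →[V.lang] B) {n : ℕ} (φ : V.ops n)
    (f : Fin n → (B →[V.lang] X)),
    ((homStr B X).funMap φ f).comp h = (homStr A X).funMap φ fun i => (f i).comp h
  postcomp : ∀ (A B X : V.Alg) (h : A →[V.lang] B) {n : ℕ} (φ : V.ops n)
    (f : Fin n → (X →[V.lang] A)),
    h.comp ((homStr X A).funMap φ f) = (homStr X B).funMap φ fun i => h.comp (f i)

/-- `V` has the self-enhancing property. -/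
def IsSelfEnhancing (V : AlgType.{u}) : Prop := Nonempty V.SelfEnhancement

/-! ## `W`-algebras and modules -/

/-- A `W`-algebra, i.e. a commutative monoid object in `V`-algebras: a `V`-algebra with a
commutative multiplicative monoid structure that distributes over all operators. -/
structure WAlg (V : AlgType.{u}) where
  carrier : Type u
  [str : V.lang.Structure carrier]
  satisfies : V.Satisfies str
  [monoid : CommMonoid carrier]
  mul_op : ∀ {n : ℕ} (φ : V.ops n) (a : carrier) (b : Fin n → carrier),
    a * FirstOrder.Language.Structure.funMap (L := V.lang) φ b = FirstOrder.Language.Structure.funMap (L := V.lang) φ fun i => a * b i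

namespace WAlg

variable {V : AlgType.{u}}

instance : CoeSort V.WAlg (Type u) := ⟨WAlg.carrier⟩

instance (R : V.WAlg) : V.lang.Structure R := R.str

instance (R : V.WAlg) : CommMonoid R := R.monoid

/-- Homomorphisms of `W`-algebras. -/
@[ext]
structure Hom (R S : V.WAlg) extends R →* S where
  map_op : ∀ {n : ℕ} (φ : V.ops n) (a : Fin n → R),
    toFun (FirstOrder.Language.Structure.funMap (L := V.lang) φ a) =
      FirstOrder.Language.Structure.funMap (L := V.lang) φ fun i => toFun (a i)

instance : Category V.WAlg where
  Hom R S := Hom R S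
  id R := { MonoidHom.id R with map_op := fun _ _ => rfl }
  comp f g :=
    { g.toMonoidHom.comp f.toMonoidHom with
      map_op := fun φ a => (congrArg g.toFun (f.map_op φ a)).trans (g.map_op φ _) }

/-- The monoid homomorphism underlying a homomorphism of `W`-algebras. -/
def monoidHom {R S : V.WAlg} (f : R ⟶ S) : R →* S := Hom.toMonoidHom f

/-- A module over the `W`-algebra `R`: a `V`-algebra `M` with a bilinear action `R × M → M`,
i.e. an action `R ⊗ M → M` of the monoid object `R`. -/
structure RMod (R : V.WAlg) where
  carrier : Type u
  [str : V.lang.Structure carrier]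
  satisfies : V.Satisfies str
  [action : MulAction R carrier]
  smul_op : ∀ {n : ℕ} (φ : V.ops n) (r : R) (m : Fin n → carrier),
    r • FirstOrder.Language.Structure.funMap (L := V.lang) φ m = FirstOrder.Language.Structure.funMap (L := V.lang) φ fun i => r • m i
  op_smul : ∀ {n : ℕ} (φ : V.ops n) (r : Fin n → R) (m : carrier),
    FirstOrder.Language.Structure.funMap (L := V.lang) φ r • m = FirstOrder.Language.Structure.funMap (L := V.lang) φ fun i => r i • m

instance (R : V.WAlg) : CoeSort R.RMod (Type u) := ⟨RMod.carrier⟩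

instance (R : V.WAlg) (M : R.RMod) : V.lang.Structure M := M.str

instance (R : V.WAlg) (M : R.RMod) : MulAction R M := M.action

/-- An ideal of `R` is an `R`-submodule of `R`. -/
structure IsIdeal (R : V.WAlg) (I : Set R) : Prop where
  op_mem : ∀ {n : ℕ} (φ : V.ops n) (a : Fin n → R), (∀ i, a i ∈ I) →
    FirstOrder.Language.Structure.funMap (L := V.lang) φ a ∈ I
  mul_mem : ∀ r a : R, a ∈ I → r * a ∈ I

/-- The ideal generated by a subset. -/
def idealSpan (R : V.WAlg) (s : Set R) : Set R := ⋂₀ {I | R.IsIdeal I ∧ s ⊆ I}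

end WAlg

end AlgType

/-! ## Coherent Grothendieck topologies -/

namespace CohSite

variable {C : Type u} [Category.{v} C]

/-- `T` is a set of pullbacks along `f` of the members of `S`, with every member of `S`
represented: `T` is `X ×_Y S`. -/
def IsBaseChange {X Y : C} (f : X ⟶ Y) (S : Presieve Y) (T : Presieve X) : Prop :=
  (∀ ⦃U : C⦄ (a : U ⟶ Y), S a → ∃ (P : C) (p : P ⟶ X) (q : P ⟶ U), IsPullback p q f a ∧ T p) ∧
  (∀ ⦃P : C⦄ (p : P ⟶ X), T p → ∃ (U : C) (a : U ⟶ Y) (q : P ⟶ U), S a ∧ IsPullback p q f a)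

variable (E : MorphismProperty C)

/-- `Ω₀(X)`: the finite sets of `E`-morphisms with target `X`. -/
structure FinOpen (X : C) where
  arrows : Presieve X
  finite : arrows.uncurry.Finite
  mem : ∀ ⦃U : C⦄ (a : U ⟶ X), arrows a → E a

/-- A coherent Grothendieck topology made of finite sets of `E`-morphisms,
all of which satisfy descent. -/
structure IsCoherentTopology (J : Precoverage C) : Prop where
  finite : ∀ (X : C) (S : Presieve X), S ∈ J X → S.uncurry.Finite
  mem : ∀ (X : C) (S : Presieve X), S ∈ J X → ∀ ⦃U : C⦄ (a : U ⟶ X), S a → E a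
  /-- Exactness of `∐ Uᵢ ×_X Uⱼ ⇉ ∐ Uᵢ → X`: morphisms from `X` to any object `Z` are the same
  as compatible families of morphisms `Uᵢ ⟶ Z`. -/
  descent : ∀ (X : C) (S : Presieve X), S ∈ J X →
    ∀ Z : C, Presieve.IsSheafFor (yoneda.obj Z) S
  id_mem : ∀ X : C, Presieve.singleton (𝟙 X) ∈ J X
  superset : ∀ (X : C) (S T : FinOpen E X), S.arrows ≤ T.arrows →
    S.arrows ∈ J X → T.arrows ∈ J X
  baseChange : ∀ {X Y : C} (f : X ⟶ Y) (S : Presieve Y) (T : Presieve X), S ∈ J Y →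
    T.uncurry.Finite → IsBaseChange f S T → T ∈ J X
  isLocal : ∀ (X : C) (S T : FinOpen E X), S.arrows ∈ J X →
    (∀ ⦃U : C⦄ (a : U ⟶ X), S.arrows a → ∃ T' ∈ J U, IsBaseChange a T.arrows T') →
    T.arrows ∈ J X

variable {E}

namespace FinOpen

/-- The set `{U ⟶ X}` with one element. -/
def single {X U : C} (a : U ⟶ X) (ha : E a) : FinOpen E X where
  arrows := Presieve.singleton a
  finite := by rw [Presieve.uncurry_singleton]; exact Set.finite_singleton _
  mem := by rintro _ _ ⟨⟩; exact ha

/-- The relation `{Uᵢ} ≺ {Vⱼ}`: for all `i`, `{Uᵢ ×_X Vⱼ ⟶ Uᵢ}ⱼ` covers `Uᵢ`. -/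
def Prec (J : Precoverage C) {X : C} (S T : FinOpen E X) : Prop :=
  ∀ ⦃U : C⦄ (a : U ⟶ X), S.arrows a → ∃ T' ∈ J U, IsBaseChange a T.arrows T'

/-- `K` is a set `{Uᵢ ×_X Vⱼ ⟶ X}` for `S = {Uᵢ}` and `T = {Vⱼ}`. -/
def IsMeet {X : C} (S T K : FinOpen E X) : Prop :=
  (∀ ⦃U V : C⦄ (a : U ⟶ X) (b : V ⟶ X), S.arrows a → T.arrows b →
    ∃ (P : C) (p : P ⟶ U) (q : P ⟶ V), IsPullback p q a b ∧ K.arrows (p ≫ a)) ∧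
  (∀ ⦃P : C⦄ (k : P ⟶ X), K.arrows k →
    ∃ (U V : C) (a : U ⟶ X) (b : V ⟶ X) (p : P ⟶ U) (q : P ⟶ V),
      S.arrows a ∧ T.arrows b ∧ IsPullback p q a b ∧ k = p ≫ a)

end FinOpen

variable (E)

/-- A point of `Spec X`. Let `Ω₁(X)` be the distributive lattice `Ω₀(X) / ≡` of the preorder `≺`,
with join given by union and meet by `{Uᵢ ×_X Vⱼ}`. The points of the coherent space with lattice
of quasi-compact open subsets `Ω₁(X)` are the bounded lattice homomorphisms `Ω₁(X) → {0, 1}`, that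
is, the functions on `Ω₀(X)` with the following properties. -/
@[ext]
structure SpecPoint (J : Precoverage C) (X : C) where
  val : FinOpen E X → Prop
  le_of_prec : ∀ S T : FinOpen E X, S.Prec J T → val S → val T
  map_zero : ∀ S : FinOpen E X, S.arrows = ⊥ → ¬ val S
  map_one : ∀ S : FinOpen E X, S.arrows = Presieve.singleton (𝟙 X) → val S
  map_join : ∀ S T K : FinOpen E X, K.arrows = S.arrows ⊔ T.arrows → (val K ↔ val S ∨ val T)
  map_meet : ∀ S T K : FinOpen E X, S.IsMeet T K → (val K ↔ val S ∧ val T)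

/-- The quasi-compact open subset of `Spec X` given by an element of `Ω₀(X)`. -/
def basicOpen (J : Precoverage C) {X : C} (S : FinOpen E X) : Set (SpecPoint E J X) :=
  {x | x.val S}

instance (J : Precoverage C) (X : C) : TopologicalSpace (SpecPoint E J X) :=
  generateFrom (Set.range (basicOpen E J))

/-- The underlying space of `Spec X`. -/
def Spec (J : Precoverage C) (X : C) : TopCat := TopCat.of (SpecPoint E J X)

end CohSite

/-! ## Localizations -/

/-- The relation `(x, s) ≡ (y, t) ↔ ∃ c ∈ S, c t x = c s y` defining `S⁻¹M`. -/
def localizationSetoid {R : Type u} [CommMonoid R] (S : Submonoid R) (M : Type v)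
    [MulAction R M] : Setoid (M × S) where
  r p q := ∃ c : S, ((c : R) * q.2) • p.1 = ((c : R) * p.2) • q.1
  iseqv :=
    { refl := fun _ => ⟨1, rfl⟩
      symm := fun ⟨c, h⟩ => ⟨c, h.symm⟩
      trans := by
        rintro ⟨x, s⟩ ⟨y, t⟩ ⟨z, r⟩ ⟨c, h⟩ ⟨d, k⟩
        refine ⟨c * d * t, ?_⟩
        have h' := congrArg (fun m => ((d : R) * r) • m) h
        have k' := congrArg (fun m => ((c : R) * s) • m) k
        simp only [smul_smul] at h' k'
        have e1 : ((c * d * t : S) : R) * r = (d : R) * r * ((c : R) * t) := by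
          push_cast; simp only [mul_comm, mul_left_comm]
        have e2 : ((c * d * t : S) : R) * s = (c : R) * s * ((d : R) * t) := by
          push_cast; simp only [mul_comm, mul_left_comm]
        have e3 : (d : R) * r * ((c : R) * s) = (c : R) * s * ((d : R) * r) := mul_comm _ _
        simp only [e1, e2]
        rw [h', e3, k'] }

/-- The localization `S⁻¹M`. -/
def LocalizedSet {R : Type u} [CommMonoid R] (S : Submonoid R) (M : Type v) [MulAction R M] :
    Type (max u v) :=
  Quotient (localizationSetoid S M)

/-- The canonical map `S⁻¹M → T⁻¹M` for `S ≤ T`. -/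
def LocalizedSet.map {R : Type u} [CommMonoid R] {S T : Submonoid R} (h : S ≤ T) (M : Type v)
    [MulAction R M] : LocalizedSet S M → LocalizedSet T M :=
  Quotient.map (fun p => (p.1, ⟨p.2, h p.2.2⟩))
    fun _ _ ⟨c, hc⟩ => ⟨⟨c, h c.2⟩, hc⟩

namespace AlgType.WAlg

variable {V : AlgType.{u}}

/-- The class `E` in the opposite category of `W`-algebras: the localizations `R → S⁻¹R`
with `S` a finitely generated multiplicative system. -/
def localizations (V : AlgType.{u}) : MorphismProperty V.WAlgᵒᵖ :=
  fun _ R a => ∃ S : Submonoid R.unop, S.FG ∧ S.IsLocalizationMap (monoidHom a.unop)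

/-- The Zariski topology: the finite sets `{R_{fᵢ}}` such that the ideal `(fᵢ)ᵢ` is unital. -/
def zariski (V : AlgType.{u}) : Precoverage V.WAlgᵒᵖ where
  coverings R := {S | ∃ (n : ℕ) (f : Fin n → R.unop) (A : Fin n → V.WAlgᵒᵖ) (a : ∀ i, A i ⟶ R),
    (∀ i, (Submonoid.powers (f i)).IsLocalizationMap (monoidHom (a i).unop)) ∧
    idealSpan R.unop (Set.range f) = Set.univ ∧ S = Presieve.ofArrows A a}

/-! ## The sheaf associated with a module -/

/-- An affine open subset of `Spec R`: an `E`-morphism to `R`, in the opposite category. -/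
structure AffineOpen (R : V.WAlg) where
  obj : Over (op R)
  mem : localizations V obj.hom

namespace AffineOpen

/-- The elements of `R` that become invertible in `A`. -/
def inverted {R : V.WAlg} (A : AffineOpen R) : Submonoid R :=
  (IsUnit.submonoid A.obj.left.unop).comap (monoidHom A.obj.hom.unop)

/-- An affine open subset as an element of `Ω₀(R)`. -/
def toFinOpen {R : V.WAlg} (A : AffineOpen R) : CohSite.FinOpen (localizations V) (op R) :=
  CohSite.FinOpen.single A.obj.hom A.mem

lemma inverted_le {R : V.WAlg} {A B : AffineOpen R} (g : B.obj ⟶ A.obj) :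
    A.inverted ≤ B.inverted := by
  intro r hr
  have hw : monoidHom B.obj.hom.unop r =
      monoidHom g.left.unop (monoidHom A.obj.hom.unop r) := by
    rw [← Over.w g]; rfl
  change IsUnit (monoidHom B.obj.hom.unop r)
  rw [hw]
  exact IsUnit.map (monoidHom g.left.unop) hr

/-- `A ⊗_R M`, for a localization `A` of `R`: the localization of `M` at the elements that become
invertible in `A`. -/
abbrev tensor {R : V.WAlg} (A : AffineOpen R) (M : R.RMod) : Type u :=
  LocalizedSet A.inverted M

/-- The restriction map `A ⊗_R M → B ⊗_R M`. -/
def res {R : V.WAlg} {A B : AffineOpen R} (g : B.obj ⟶ A.obj) (M : R.RMod) :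
    A.tensor M → B.tensor M :=
  LocalizedSet.map (inverted_le g) M

end AffineOpen

variable (J : Precoverage V.WAlgᵒᵖ) {R : V.WAlg} (M : R.RMod)

/-- `Spec R` for the topology `J`. -/
abbrev spec (R : V.WAlg) : TopCat := CohSite.Spec (localizations V) J (op R)

/-- The point `x` lies in the affine open subset `A`. -/
def IsIn (x : spec J R) (A : AffineOpen R) : Prop :=
  CohSite.SpecPoint.val x A.toFinOpen

/-- The stalk at `x` of the presheaf `A ↦ A ⊗_R M` on affine open subsets: elements of `A ⊗_R M`,
for `A` containing `x`, up to equality on a smaller affine open subset containing `x`. -/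
def ModStalk (x : spec J R) : Type (u + 1) :=
  Quot fun s t : (Σ A : {A : AffineOpen R // IsIn J x A}, A.1.tensor M) =>
    ∃ (B : AffineOpen R) (_ : IsIn J x B) (g : B.obj ⟶ s.1.1.obj) (h : B.obj ⟶ t.1.1.obj),
      AffineOpen.res g M s.2 = AffineOpen.res h M t.2

/-- The germ at `x` of an element of `A ⊗_R M`. -/
def germ (x : spec J R) (A : AffineOpen R) (hx : IsIn J x A) (m : A.tensor M) :
    ModStalk J M x :=
  Quot.mk _ ⟨⟨A, hx⟩, m⟩

/-- The families of germs that come from one element of one `A ⊗_R M`. -/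
def isGermFamily : TopCat.PrelocalPredicate (ModStalk J M) where
  pred {U} s := ∃ (A : AffineOpen R) (m : A.tensor M),
    ∀ x : U, ∃ hx : IsIn J x.1 A, s x = germ J M x.1 A hx m
  res i _ := fun ⟨A, m, h⟩ => ⟨A, m, fun x => h (i x)⟩

/-- The (sheaf of sets underlying the) sheaf `Sh(M)` on `Spec R`, i.e. the sheafification of
`A ↦ A ⊗_R M`: its sections are the families of germs that locally come from elements
of `A ⊗_R M`. -/
def moduleSheaf : TopCat.Sheaf (Type (u + 1)) (spec J R) :=
  TopCat.subsheafToTypes (isGermFamily J M).sheafify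

/-- `Sh(M) = 0`. As there is a constant operator, all sections form non-empty sets, and the sheaf of
modules is zero if and only if it has at most one section on every open subset. -/
def ModuleSheafIsZero : Prop :=
  ∀ U : Opens (spec J R), Subsingleton ((moduleSheaf J M).presheaf.obj (op U))

end AlgType.WAlg

/-! The argument is commutative ring theory without subtraction. An ideal contained in no prime is
the unit ideal (`IsIdeal.one_mem_of_forall_prime`), and the sets {c | c x = c y} replace
annihilators: they are ideals because the multiplication distributes over all operators. By
`mem_zariski_iff`, a finite family of localizations is a Zariski covering exactly when every prime
lies in the image of a member. The axioms then amount to moving primes along localizations, and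
descent follows by applying the prime criterion to ideals of denominators. If Sh(M) = 0, any m, m'
have the same germ at every prime p, so c m = c m' for some c outside p; hence this holds for c = 1.

Maximality comes from descent. Suppose that a covering of R in a coherent topology misses a prime p,
so that each member inverts some r in p. Let R[ε] be the extension with ε² = 0, and R[pε] its
subalgebra generated by R and pε. Multiplication by r in p maps R[ε] into R[pε], so the inclusion
R[pε] → R[ε] becomes invertible wherever r does, hence locally for the base change of the covering
to R[pε]. Descent glues the local inverses to a homomorphism R[ε] → R[pε]; descent for the base
change to R[ε] shows that following it by the inclusion gives the identity. Hence ε lies in R[pε],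
and its coefficient 1 lies in p, which is absurd.

In the absence of direct sums, these extensions are realised (`sqZero`) as algebras of endomorphisms
of R × R generated by scalars and shifts (a, b) ↦ (0, r a). They are commutative because all
operators commute with each other (`IsSelfEnhancing.entropic`). -/

open FirstOrder.Language.Structure (funMap)

/-! ## Localization maps of commutative monoids -/

namespace Submonoid.IsLocalizationMap

lemma exists_of_eq_pi {M N ι : Type*} [Finite ι] [CommMonoid M] [CommMonoid N] {f : M →* N}
    {S : Submonoid M} (hf : S.IsLocalizationMap f) {x y : ι → M} (h : ∀ i, f (x i) = f (y i)) :
    ∃ c ∈ S, ∀ i, c * x i = c * y i := by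
  have ⟨_⟩ := nonempty_fintype ι
  classical
  choose c hc using fun i => hf.exists_of_eq (h i)
  refine ⟨∏ i, (c i : M), S.prod_mem fun i _ => (c i).2, fun i => ?_⟩
  rw [← Finset.univ.mul_prod_erase _ (Finset.mem_univ i), mul_comm (c i : M), mul_assoc, hc,
    mul_assoc]

lemma surj_mem {M N : Type*} [CommMonoid M] [CommMonoid N] {f : M →* N}
    {S : Submonoid M} (hf : S.IsLocalizationMap f) (z : N) : ∃ s ∈ S, ∃ x, z * f s = f x := by
  obtain ⟨⟨x, s⟩, h⟩ := hf.surj z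
  exact ⟨s, s.2, x, h⟩

lemma isUnit_of_mem {M N : Type*} [CommMonoid M] [CommMonoid N] {f : M →* N}
    {S : Submonoid M} (hf : S.IsLocalizationMap f) {s : M} (hs : s ∈ S) : IsUnit (f s) :=
  hf.map_units ⟨s, hs⟩

lemma exists_mem_of_eq {M N : Type*} [CommMonoid M] [CommMonoid N] {f : M →* N}
    {S : Submonoid M} (hf : S.IsLocalizationMap f) {x y : M} (h : f x = f y) :
    ∃ c ∈ S, c * x = c * y := by
  obtain ⟨c, hc⟩ := hf.exists_of_eq h
  exact ⟨c, c.2, hc⟩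

/-- An element that becomes invertible in the localization at `S` divides an element of `S`. -/
lemma exists_mul_mem {M N : Type*} [CommMonoid M] [CommMonoid N] {f : M →* N}
    {S : Submonoid M} (hf : S.IsLocalizationMap f) {x : M} (h : IsUnit (f x)) :
    ∃ y, x * y ∈ S := by
  obtain ⟨w, hw⟩ := h.exists_right_inv
  obtain ⟨s, hs, y, hy⟩ := hf.surj_mem w
  have : f (x * y) = f s := by rw [map_mul, ← hy, ← mul_assoc, hw, one_mul]
  obtain ⟨c, hc, h⟩ := hf.exists_mem_of_eq this
  exact ⟨c * y, by rw [mul_left_comm, h]; exact S.mul_mem hc hs⟩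

/-- A localization at a finitely generated submonoid is the localization at one element. -/
lemma exists_powers {M N : Type*} [CommMonoid M] [CommMonoid N] {f : M →* N}
    {S : Submonoid M} (hf : S.IsLocalizationMap f) (hS : S.FG) :
    ∃ r : M, (Submonoid.powers r).IsLocalizationMap f := by
  obtain ⟨t, rfl⟩ := hS
  -- The single element is the product of the generators: each element of the submonoid divides one
  -- of its powers.
  have hdvd : ∀ s ∈ Submonoid.closure (t : Set M), ∃ n : ℕ, s ∣ (∏ x ∈ t, x) ^ n := by
    intro s hs
    induction hs using Submonoid.closure_induction with
    | mem x hx => exact ⟨1, by rw [pow_one]; exact Finset.dvd_prod_of_mem _ hx⟩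
    | one => exact ⟨0, by simp⟩
    | mul x y _ _ hx hy =>
      obtain ⟨n, hn⟩ := hx
      obtain ⟨m, hm⟩ := hy
      exact ⟨n + m, by rw [pow_add]; exact mul_dvd_mul hn hm⟩
  have hmem : ∀ s ∈ Submonoid.powers (∏ x ∈ t, x), s ∈ Submonoid.closure (t : Set M) := by
    rintro _ ⟨n, rfl⟩
    exact Submonoid.pow_mem _ (Submonoid.prod_mem _ fun x hx => Submonoid.subset_closure hx) n
  refine ⟨∏ x ∈ t, x, ⟨fun y => hf.isUnit_of_mem (hmem _ y.2), fun z => ?_, fun {x y} h => ?_⟩⟩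
  · obtain ⟨s, hs, x, hx⟩ := hf.surj_mem z
    obtain ⟨n, d, hn⟩ := hdvd s hs
    refine ⟨⟨x * d, ⟨_, n, rfl⟩⟩, ?_⟩
    simp only
    rw [hn, map_mul, ← mul_assoc, hx, map_mul]
  · obtain ⟨s, hs, e⟩ := hf.exists_mem_of_eq h
    obtain ⟨n, d, hn⟩ := hdvd s hs
    refine ⟨⟨_, n, rfl⟩, ?_⟩
    simp only
    rw [hn, mul_comm s, mul_assoc, e, mul_assoc]

end Submonoid.IsLocalizationMap

/-! ### Transfer of equations along families of homomorphisms -/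

namespace AlgType

variable {V : AlgType.{u}}

/-- The equations of `V` pass to every algebra with a jointly injective family of homomorphisms to
`V`-algebras. -/
lemma Satisfies.of_separating {A : Type v} (sA : V.lang.Structure A) {ι : Type w} {B : ι → Type u}
    (sB : ∀ i, V.lang.Structure (B i)) (hB : ∀ i, V.Satisfies (sB i))
    (h : ∀ i, A →[V.lang] B i) (hh : ∀ x y, (∀ i, h i x = h i y) → x = y) : V.Satisfies sA := by
  intro n s t hst a
  refine hh _ _ fun i => ?_
  rw [← FirstOrder.Language.HomClass.realize_term (h i),
    ← FirstOrder.Language.HomClass.realize_term (h i)]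
  exact hB i n s t hst _

/-- The equations of `V` pass to every algebra all of whose finite families are images of families
of elements of one `V`-algebra. -/
lemma Satisfies.of_covering {A : Type v} (sA : V.lang.Structure A) {B : Type u}
    (sB : V.lang.Structure B) (hB : V.Satisfies sB)
    (h : ∀ (n : ℕ) (a : Fin n → A), ∃ (g : B →[V.lang] A) (b : Fin n → B), a = g ∘ b) :
    V.Satisfies sA := by
  intro n s t hst a
  obtain ⟨g, b, rfl⟩ := h n a
  rw [FirstOrder.Language.HomClass.realize_term g,
    FirstOrder.Language.HomClass.realize_term g, hB n s t hst b]

namespace WAlg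

lemma op_mul (R : V.WAlg) {n : ℕ} (φ : V.ops n) (a : R) (b : Fin n → R) :
    funMap (L := V.lang) φ b * a = funMap (L := V.lang) φ fun i => b i * a := by
  rw [mul_comm, R.mul_op]
  simp only [mul_comm]

lemma monoidHom_op {R S : V.WAlg} (f : R ⟶ S) {n : ℕ} (φ : V.ops n) (a : Fin n → R) :
    monoidHom f (funMap (L := V.lang) φ a) = funMap (L := V.lang) φ fun i => monoidHom f (a i) :=
  Hom.map_op f φ a

lemma monoidHom_comp {R S T : V.WAlg} (f : R ⟶ S) (g : S ⟶ T) (x : R) :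
    monoidHom (f ≫ g) x = monoidHom g (monoidHom f x) := rfl

lemma monoidHom_id (R : V.WAlg) (x : R) : monoidHom (𝟙 R) x = x := rfl

lemma hom_ext {R S : V.WAlg} {f g : R ⟶ S} (h : ∀ x, monoidHom f x = monoidHom g x) : f = g :=
  Hom.ext (funext h)

/-- A monoid homomorphism compatible with the operators, as a morphism. -/
def ofMonoidHom {R S : V.WAlg} (f : R →* S)
    (hf : ∀ {n : ℕ} (φ : V.ops n) (a : Fin n → R),
      f (funMap (L := V.lang) φ a) = funMap (L := V.lang) φ fun i => f (a i)) : R ⟶ S :=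
  show Hom R S from { f with map_op := hf }

/-! ### Localization of a `W`-algebra -/

section Localization

variable (R : V.WAlg) (S : Submonoid R)

/-- The canonical monoid homomorphism `R → S⁻¹R`. -/
abbrev toLocalization : R →* Localization S := (Localization.monoidOf S).toMonoidHom

lemma toLocalization_isLocalizationMap : S.IsLocalizationMap (toLocalization R S) :=
  (Localization.monoidOf S).isLocalizationMap

/-- Finitely many fractions have a common denominator, so φ(y₁/t, …, yₙ/t) should be φ(y)/t.
Quantifying over all common denominators records that the value does not depend on the choice. -/
lemma exists_localization_op {n : ℕ} (φ : V.ops n) (a : Fin n → Localization S) :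
    ∃ z : Localization S, ∀ s ∈ S, ∀ x : Fin n → R,
      (∀ i, a i * toLocalization R S s = toLocalization R S (x i)) →
        z * toLocalization R S s = toLocalization R S (funMap (L := V.lang) φ x) := by
  set f := toLocalization R S
  have hf : S.IsLocalizationMap f := toLocalization_isLocalizationMap R S
  obtain ⟨t, y, hy⟩ := hf.surj_pi_of_finite a
  obtain ⟨u, hu⟩ := hf.map_units t
  refine ⟨f (funMap (L := V.lang) φ y) * ↑u⁻¹, fun s hs x hx => ?_⟩
  have key : ∀ i, f (t * x i) = f (s * y i) := fun i => by
    rw [map_mul, map_mul, ← hx, ← hy, mul_left_comm, mul_comm (f t), mul_left_comm]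
  obtain ⟨c, hc, h⟩ := hf.exists_of_eq_pi key
  have h' : c * (t * funMap (L := V.lang) φ x) = c * (s * funMap (L := V.lang) φ y) := by
    simp only [R.mul_op, h]
  have h'' := congrArg f h'
  rw [map_mul, map_mul f c, (hf.isUnit_of_mem hc).mul_right_inj, map_mul, map_mul, ← hu] at h''
  rw [mul_right_comm, Units.mul_inv_eq_iff_eq_mul, mul_comm, ← h'', mul_comm]

noncomputable instance localizationStructure : V.lang.Structure (Localization S) where
  funMap φ a := (exists_localization_op R S φ a).choose
  RelMap r := r.elim

lemma localization_op_mul {n : ℕ} (φ : V.ops n) (a : Fin n → Localization S) {s : R} (hs : s ∈ S)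
    {x : Fin n → R} (hx : ∀ i, a i * toLocalization R S s = toLocalization R S (x i)) :
    funMap (L := V.lang) φ a * toLocalization R S s =
      toLocalization R S (funMap (L := V.lang) φ x) :=
  (exists_localization_op R S φ a).choose_spec s hs x hx

lemma localization_mul_op {n : ℕ} (φ : V.ops n) (a : Localization S) (b : Fin n → Localization S) :
    a * funMap (L := V.lang) φ b = funMap (L := V.lang) φ fun i => a * b i := by
  have hf := toLocalization_isLocalizationMap R S
  obtain ⟨s, hs, x, hx⟩ := hf.surj_mem a
  obtain ⟨t, y, hy⟩ := hf.surj_pi_of_finite b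
  rw [← (hf.isUnit_of_mem (S.mul_mem hs t.2)).mul_left_inj,
    localization_op_mul R S φ (fun i => a * b i) (S.mul_mem hs t.2) (x := fun i => x * y i),
    ← R.mul_op, map_mul, map_mul, ← localization_op_mul R S φ b t.2 hy, ← hx]
  · exact mul_mul_mul_comm _ _ _ _
  · intro i
    rw [map_mul, map_mul, ← hy, ← hx]
    exact mul_mul_mul_comm _ _ _ _

/-- Any finite family of fractions with common denominator t is the image of a family in R under r ↦
r/t, which respects the operators though not the product. -/
lemma localization_satisfies : V.Satisfies (localizationStructure R S) := by
  refine Satisfies.of_covering _ R.str R.satisfies fun n a => ?_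
  have hf := toLocalization_isLocalizationMap R S
  obtain ⟨t, y, hy⟩ := hf.surj_pi_of_finite a
  obtain ⟨u, hu⟩ := hf.map_units t
  refine ⟨⟨fun r => toLocalization R S r * ↑u⁻¹, fun φ x => ?_, fun r => r.elim⟩, y, ?_⟩
  · rw [Units.mul_inv_eq_iff_eq_mul, hu]
    symm
    refine localization_op_mul R S φ _ t.2 fun i => ?_
    simp [← hu]
  · funext i
    change a i = toLocalization R S (y i) * ↑u⁻¹
    rw [Units.eq_mul_inv_iff_mul_eq, hu, hy]

/-- The localization `S⁻¹R` of a `W`-algebra. -/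
noncomputable def loc : V.WAlg where
  carrier := Localization S
  str := localizationStructure R S
  satisfies := localization_satisfies R S
  mul_op := localization_mul_op R S

/-- The canonical homomorphism `R → S⁻¹R`. -/
noncomputable def toLoc : R ⟶ R.loc S :=
  ofMonoidHom (S := R.loc S) (toLocalization R S) fun φ a => by
    have := localization_op_mul R S φ (fun i => toLocalization R S (a i)) S.one_mem
      (x := a) (by simp)
    rw [map_one, mul_one] at this
    exact this.symm

lemma toLoc_isLocalizationMap : S.IsLocalizationMap (monoidHom (R.toLoc S)) :=
  toLocalization_isLocalizationMap R S

end Localization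

variable {R A B : V.WAlg} {S : Submonoid R}

lemma loc_hom_ext {a : R ⟶ A} (ha : S.IsLocalizationMap (monoidHom a)) {g h : A ⟶ B}
    (e : a ≫ g = a ≫ h) : g = h := by
  refine hom_ext fun x => ?_
  have e' : ∀ r, monoidHom g (monoidHom a r) = monoidHom h (monoidHom a r) := fun r => by
    rw [← monoidHom_comp, e, monoidHom_comp]
  obtain ⟨s, hs, y, hy⟩ := ha.surj_mem x
  have hu := (ha.isUnit_of_mem hs).map (monoidHom g)
  rw [← hu.mul_left_inj, ← map_mul, hy, e', e', ← map_mul, hy]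

/-- The universal property of localization. -/
lemma exists_loc_lift {a : R ⟶ A} (ha : S.IsLocalizationMap (monoidHom a)) (g : R ⟶ B)
    (hg : ∀ s ∈ S, IsUnit (monoidHom g s)) : ∃ h : A ⟶ B, a ≫ h = g := by
  let L : S.LocalizationMap A := ⟨(monoidHom a : R →ₙ* A), ha⟩
  have hg' : ∀ s : S, IsUnit (monoidHom g s) := fun s => hg s s.2
  have hL : ∀ r, L.lift hg' (monoidHom a r) = monoidHom g r := fun r => L.lift_eq hg' r
  refine ⟨ofMonoidHom (L.lift hg') fun φ x => ?_, hom_ext hL⟩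
  -- The lift is so far only multiplicative; its compatibility with φ is checked after clearing a
  -- common denominator of the arguments.
  obtain ⟨s, y, hy⟩ := ha.surj_pi_of_finite x
  have hx : ∀ i, L.lift hg' (x i) * monoidHom g s = monoidHom g (y i) := fun i => by
    rw [← hL, ← map_mul, hy, hL]
  rw [← (hg' s).mul_left_inj, ← hL, ← map_mul, op_mul, op_mul, hL]
  simp only [hx, hy, ← monoidHom_op, hL]

end WAlg

end AlgType

namespace AlgType.WAlg

variable {V : AlgType.{u}}

/-! ### Base change of localizations -/

lemma isUnit_hom {R R' : V.WAlg} (f : R ⟶ R') {x : R} (h : IsUnit x) : IsUnit (monoidHom f x) :=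
  h.map _

/-- The universal property of localization gives both sides: a homomorphism from R' extends over A
exactly when it inverts the image of S. -/
lemma exists_isPushout_toLoc {R R' A : V.WAlg} {S : Submonoid R} (f : R ⟶ R') {a : R ⟶ A}
    (ha : S.IsLocalizationMap (monoidHom a)) :
    ∃ q : A ⟶ R'.loc (S.map (monoidHom f)), IsPushout a f q (R'.toLoc _) := by
  have hL := toLoc_isLocalizationMap R' (S.map (monoidHom f))
  obtain ⟨q, hq⟩ := exists_loc_lift ha (f ≫ R'.toLoc (S.map (monoidHom f))) fun s hs =>
    hL.isUnit_of_mem (Submonoid.mem_map_of_mem _ hs)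
  have key : ∀ s : Limits.PushoutCocone a f,
      ∃ l : R'.loc (S.map (monoidHom f)) ⟶ s.pt, R'.toLoc _ ≫ l = s.inr := fun s => by
    refine exists_loc_lift hL s.inr ?_
    rintro _ ⟨r, hr, rfl⟩
    rw [← monoidHom_comp, ← s.condition, monoidHom_comp]
    exact isUnit_hom _ (ha.isUnit_of_mem hr)
  choose l hl using key
  refine ⟨q, ⟨⟨hq⟩, ⟨Limits.PushoutCocone.IsColimit.mk hq l (fun s => loc_hom_ext ha ?_) hl
    fun s m _ h => loc_hom_ext hL (h.trans (hl s).symm)⟩⟩⟩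
  rw [← Category.assoc, hq, Category.assoc, hl, s.condition]

lemma isLocalizationMap_comp_iso {R A B : V.WAlg} {S : Submonoid R} {a : R ⟶ A}
    (ha : S.IsLocalizationMap (monoidHom a)) (e : A ≅ B) :
    S.IsLocalizationMap (monoidHom (a ≫ e.hom)) := by
  have h1 : ∀ x, monoidHom e.inv (monoidHom e.hom x) = x := fun x => by
    rw [← monoidHom_comp, e.hom_inv_id, monoidHom_id]
  have h2 : ∀ x, monoidHom e.hom (monoidHom e.inv x) = x := fun x => by
    rw [← monoidHom_comp, e.inv_hom_id, monoidHom_id]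
  exact ha.mulEquiv_comp (MulEquiv.mk ⟨monoidHom e.hom, monoidHom e.inv, h1, h2⟩ (map_mul _))

variable {X Y U P : V.WAlgᵒᵖ} {f : X ⟶ Y} {a : U ⟶ Y} {p : P ⟶ X} {q : P ⟶ U}
  {S : Submonoid Y.unop}

lemma exists_isPullback_toLoc (f : X ⟶ Y) (ha : S.IsLocalizationMap (monoidHom a.unop)) :
    ∃ q : op (X.unop.loc (S.map (monoidHom f.unop))) ⟶ U,
      IsPullback (X.unop.toLoc _).op q f a := by
  obtain ⟨q, hq⟩ := exists_isPushout_toLoc f.unop ha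
  exact ⟨q.op, hq.op⟩

/-- The base change of a localization is a localization. -/
lemma isLocalizationMap_of_isPullback (h : IsPullback p q f a)
    (ha : S.IsLocalizationMap (monoidHom a.unop)) :
    (S.map (monoidHom f.unop)).IsLocalizationMap (monoidHom p.unop) := by
  obtain ⟨q', h'⟩ := exists_isPullback_toLoc f ha
  have e : p.unop = X.unop.toLoc (S.map (monoidHom f.unop)) ≫ (h.isoIsPullback _ _ h').unop.hom :=
    congrArg Quiver.Hom.unop (h.isoIsPullback_hom_fst _ _ h').symm
  rw [e]
  exact isLocalizationMap_comp_iso (toLoc_isLocalizationMap _ _) _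

lemma localizations_of_isPullback (h : IsPullback p q f a) (ha : localizations V a) :
    localizations V p := by
  obtain ⟨S, hS, ha⟩ := ha
  exact ⟨_, hS.map _, isLocalizationMap_of_isPullback h ha⟩

lemma exists_isPullback (f : X ⟶ Y) (ha : localizations V a) :
    ∃ (P : V.WAlgᵒᵖ) (p : P ⟶ X) (q : P ⟶ U), IsPullback p q f a := by
  obtain ⟨S, hS, ha⟩ := ha
  obtain ⟨q, h⟩ := exists_isPullback_toLoc f ha
  exact ⟨_, _, q, h⟩

/-- Choosing one pullback per member keeps the family finite, as the base change axiom requires. -/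
lemma exists_isBaseChange (f : X ⟶ Y) {T : Presieve Y} (hT : T.uncurry.Finite)
    (hl : ∀ ⦃U : V.WAlgᵒᵖ⦄ (a : U ⟶ Y), T a → localizations V a) :
    ∃ T' : Presieve X, T'.uncurry.Finite ∧ CohSite.IsBaseChange f T T' := by
  choose P p q h using fun i : T.uncurry => exists_isPullback f (hl i.1.2 i.2)
  have := hT.to_subtype
  refine ⟨Presieve.ofArrows P p, ?_, fun U a ha => ?_, ?_⟩
  · rw [Presieve.uncurry_ofArrows]
    exact Set.finite_range _
  · exact ⟨_, _, _, h ⟨⟨U, a⟩, ha⟩, .mk _⟩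
  · rintro _ _ ⟨i⟩
    exact ⟨_, _, _, i.2, h i⟩

lemma isLocalizationMap_id (R : V.WAlg) :
    (Submonoid.powers (1 : R)).IsLocalizationMap (monoidHom (𝟙 R)) := by
  refine ⟨?_, fun z => ⟨⟨z, 1⟩, by simp [monoidHom_id]⟩,
    fun {x y} h => ⟨1, by simpa [monoidHom_id] using h⟩⟩
  rintro ⟨_, n, rfl⟩
  simp

lemma localizations_id (X : V.WAlgᵒᵖ) : localizations V (𝟙 X) :=
  ⟨_, Submonoid.powers_fg 1, isLocalizationMap_id X.unop⟩

/-! ### Ideals and primes -/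

lemma idealSpan_isIdeal (R : V.WAlg) (s : Set R) : R.IsIdeal (R.idealSpan s) where
  op_mem φ a ha := Set.mem_sInter.2 fun I hI =>
    hI.1.op_mem φ a fun i => Set.mem_sInter.1 (ha i) I hI
  mul_mem r a ha := Set.mem_sInter.2 fun I hI => hI.1.mul_mem r a (Set.mem_sInter.1 ha I hI)

lemma subset_idealSpan (R : V.WAlg) (s : Set R) : s ⊆ R.idealSpan s :=
  Set.subset_sInter fun _ hI => hI.2

lemma idealSpan_subset {R : V.WAlg} {s I : Set R} (hI : R.IsIdeal I) (h : s ⊆ I) :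
    R.idealSpan s ⊆ I :=
  Set.sInter_subset_of_mem ⟨hI, h⟩

lemma IsIdeal.eq_univ {R : V.WAlg} {I : Set R} (hI : R.IsIdeal I) (h : 1 ∈ I) : I = Set.univ :=
  Set.eq_univ_of_forall fun x => by simpa using hI.mul_mem x 1 h

lemma IsIdeal.mul_mem_right {R : V.WAlg} {I : Set R} (hI : R.IsIdeal I) {a : R} (r : R)
    (h : a ∈ I) : a * r ∈ I := by
  rw [mul_comm]
  exact hI.mul_mem r a h

/-- Prime ideals of a `W`-algebra. -/
structure IsPrimeIdeal (R : V.WAlg) (p : Set R) : Prop extends R.IsIdeal p where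
  one_notMem : 1 ∉ p
  mem_or_mem : ∀ a b : R, a * b ∈ p → a ∈ p ∨ b ∈ p

lemma IsPrimeIdeal.mul_notMem {R : V.WAlg} {p : Set R} (hp : R.IsPrimeIdeal p) {a b : R}
    (ha : a ∉ p) (hb : b ∉ p) : a * b ∉ p := fun h => (hp.mem_or_mem a b h).elim ha hb

/-- The complement of a prime ideal. -/
def IsPrimeIdeal.compl {R : V.WAlg} {p : Set R} (hp : R.IsPrimeIdeal p) : Submonoid R where
  carrier := pᶜ
  mul_mem' := hp.mul_notMem
  one_mem' := hp.one_notMem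

lemma IsPrimeIdeal.comap {R R' : V.WAlg} (f : R ⟶ R') {p : Set R'} (hp : R'.IsPrimeIdeal p) :
    R.IsPrimeIdeal (monoidHom f ⁻¹' p) where
  op_mem φ a ha := by
    rw [Set.mem_preimage, monoidHom_op]
    exact hp.op_mem φ _ ha
  mul_mem r a ha := by
    rw [Set.mem_preimage, map_mul]
    exact hp.mul_mem _ _ ha
  one_notMem := by
    rw [Set.mem_preimage, map_one]
    exact hp.one_notMem
  mem_or_mem a b h := by
    rw [Set.mem_preimage, map_mul] at h
    exact hp.mem_or_mem _ _ h

/-- A proper ideal lies in a prime ideal. -/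
lemma exists_isPrimeIdeal {R : V.WAlg} {I : Set R} (hI : R.IsIdeal I) (h1 : 1 ∉ I) :
    ∃ p, R.IsPrimeIdeal p ∧ I ⊆ p := by
  obtain ⟨m, hIm, ⟨hm, hm1⟩, hmax⟩ := zorn_subset_nonempty {J | R.IsIdeal J ∧ 1 ∉ J} (by
    intro c hc hchain hne
    refine ⟨⋃₀ c, ⟨⟨fun φ a ha => ?_, fun r a ha => ?_⟩, ?_⟩, fun s => Set.subset_sUnion_of_mem⟩
    -- Operators are finitary, so all arguments lie in one member of the chain.
    · obtain ⟨J, hJ, hJa⟩ := hchain.directedOn.exists_mem_subset_of_finite_of_subset_sUnion hne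
        (Set.finite_range a) (Set.range_subset_iff.2 ha)
      exact ⟨J, hJ, (hc hJ).1.op_mem φ a fun i => hJa ⟨i, rfl⟩⟩
    · obtain ⟨J, hJ, hJa⟩ := ha
      exact ⟨J, hJ, (hc hJ).1.mul_mem r a hJa⟩
    · rintro ⟨J, hJ, hJ1⟩
      exact (hc hJ).2 hJ1) I ⟨hI, h1⟩
  refine ⟨m, ⟨hm, hm1, fun a b hab => ?_⟩, hIm⟩
  by_contra! hne
  -- The colon ideal (m : a) replaces m + (b): it contains m and b, and omits 1 because a is not in
  -- m, contradicting maximality.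
  have hJ : R.IsIdeal {x | x * a ∈ m} :=
    ⟨fun φ x hx => by rw [Set.mem_ofPred_eq, op_mul]; exact hm.op_mem φ _ hx,
      fun r x hx => by rw [Set.mem_ofPred_eq, mul_assoc]; exact hm.mul_mem r _ hx⟩
  refine hne.2 (hmax (y := {x | x * a ∈ m}) ⟨hJ, fun h => hne.1 ?_⟩
    (fun x hx => hm.mul_mem_right a hx) ?_)
  · simpa using h
  · rw [Set.mem_ofPred_eq, mul_comm]
    exact hab

/-- An ideal contained in no prime ideal is the unit ideal. -/
lemma IsIdeal.one_mem_of_forall_prime {R : V.WAlg} {I : Set R} (hI : R.IsIdeal I)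
    (h : ∀ p, R.IsPrimeIdeal p → ∃ x ∈ I, x ∉ p) : 1 ∈ I := by
  by_contra h1
  obtain ⟨p, hp, hIp⟩ := exists_isPrimeIdeal hI h1
  obtain ⟨x, hx, hxp⟩ := h p hp
  exact hxp (hIp hx)

end AlgType.WAlg

namespace AlgType.WAlg

variable {V : AlgType.{u}}

/-! ### Primes in the image of a localization -/

section PrimeIn

variable {X Y U W P : V.WAlgᵒᵖ}

/-- No element of the prime `p` becomes invertible along `a`. For a localization `a`, this says that
`p` lies in the image of `a` on prime spectra. -/
def PrimeIn (p : Set X.unop) (a : U ⟶ X) : Prop :=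
  ∀ r ∈ p, ¬ IsUnit (monoidHom a.unop r)

/-- An element that becomes invertible divides some element of S, which would then lie in p along
with it. -/
lemma PrimeIn.of_disjoint {p : Set X.unop} (hp : X.unop.IsPrimeIdeal p) {a : U ⟶ X}
    {S : Submonoid X.unop} (ha : S.IsLocalizationMap (monoidHom a.unop)) (h : ∀ s ∈ S, s ∉ p) :
    PrimeIn p a := fun r hr hu => by
  obtain ⟨y, hy⟩ := ha.exists_mul_mem hu
  exact h _ hy (hp.mul_mem_right y hr)

lemma PrimeIn.notMem {p : Set X.unop} {a : U ⟶ X} (h : PrimeIn p a)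
    {S : Submonoid X.unop} (ha : S.IsLocalizationMap (monoidHom a.unop)) {s : X.unop}
    (hs : s ∈ S) : s ∉ p := fun hsp => h s hsp (ha.isUnit_of_mem hs)

lemma PrimeIn.of_comp {p : Set X.unop} {a : U ⟶ X} {c : P ⟶ U} (h : PrimeIn p (c ≫ a)) :
    PrimeIn p a := fun r hr hu => h r hr (isUnit_hom c.unop hu)

lemma PrimeIn.of_isPullback {f : X ⟶ Y} {a : U ⟶ Y} {p : P ⟶ X} {q : P ⟶ U}
    (h : IsPullback p q f a) {m : Set X.unop} (hm : X.unop.IsPrimeIdeal m)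
    (ha : localizations V a) (hma : PrimeIn (monoidHom f.unop ⁻¹' m) a) : PrimeIn m p := by
  obtain ⟨S, -, ha⟩ := ha
  refine PrimeIn.of_disjoint hm (isLocalizationMap_of_isPullback h ha) ?_
  rintro _ ⟨s, hs, rfl⟩
  exact hma.notMem ha hs

/-- A prime in the image of a localization extends to a prime of the localization. -/
lemma PrimeIn.exists_extension {p : Set X.unop} (hp : X.unop.IsPrimeIdeal p) {a : U ⟶ X}
    (ha : localizations V a) (h : PrimeIn p a) :
    ∃ q : Set U.unop, U.unop.IsPrimeIdeal q ∧ monoidHom a.unop ⁻¹' q = p := by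
  obtain ⟨S, -, ha⟩ := ha
  have hS : ∀ s ∈ S, s ∉ p := fun s => h.notMem ha
  -- The extension consists of the fractions with numerator in p and denominator outside p;
  -- membership can be tested on any one representation with denominator outside p.
  have hmem : ∀ s ∉ p, ∀ (x : U.unop) (r : X.unop),
      x * monoidHom a.unop s = monoidHom a.unop r →
      ((∃ s ∉ p, ∃ r ∈ p, x * monoidHom a.unop s = monoidHom a.unop r) ↔ r ∈ p) := by
    refine fun s hs x r hx => ⟨fun ⟨s', hs', r', hr', hx'⟩ => ?_, fun hr => ⟨s, hs, r, hr, hx⟩⟩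
    have : monoidHom a.unop (s' * r) = monoidHom a.unop (s * r') := by
      rw [map_mul, map_mul, ← hx, ← hx', mul_left_comm, mul_comm (monoidHom a.unop s'),
        mul_left_comm]
    obtain ⟨c, hc, e⟩ := ha.exists_mem_of_eq this
    have hmem : c * (s' * r) ∈ p := e ▸ hp.mul_mem _ _ (hp.mul_mem _ _ hr')
    rw [← mul_assoc] at hmem
    exact (hp.mem_or_mem _ _ hmem).resolve_left (hp.mul_notMem (hS c hc) hs')
  have hcomap : ∀ r : X.unop, (∃ s ∉ p, ∃ r' ∈ p,
      monoidHom a.unop r * monoidHom a.unop s = monoidHom a.unop r') ↔ r ∈ p := fun r =>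
    hmem 1 hp.one_notMem _ r (by simp)
  refine ⟨{x | ∃ s ∉ p, ∃ r ∈ p, x * monoidHom a.unop s = monoidHom a.unop r},
    ⟨⟨fun φ x hx => ?_, fun y x hx => ?_⟩, fun h1 => ?_, fun x y hxy => ?_⟩, Set.ext hcomap⟩
  · obtain ⟨s, y, hy⟩ := ha.surj_pi_of_finite x
    refine (hmem s (hS s s.2) _ (funMap (L := V.lang) φ y) ?_).2
      (hp.op_mem φ y fun i => (hmem s (hS s s.2) _ _ (hy i)).1 (hx i))
    rw [op_mul, monoidHom_op]
    simp only [hy]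
  · obtain ⟨t, ht, z, hz⟩ := ha.surj_mem y
    obtain ⟨s, hs, r, hr, hx⟩ := hx
    refine ⟨t * s, hp.mul_notMem (hS t ht) hs, z * r, hp.mul_mem z r hr, ?_⟩
    rw [map_mul, map_mul, mul_mul_mul_comm, hz, hx]
  · refine hp.one_notMem ((hcomap 1).1 ?_)
    rw [map_one]
    exact h1
  · obtain ⟨s, hs, x', hx⟩ := ha.surj_mem x
    obtain ⟨t, ht, y', hy⟩ := ha.surj_mem y
    have := (hmem (s * t) (hp.mul_notMem (hS s hs) (hS t ht)) (x * y) (x' * y')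
      (by rw [map_mul, map_mul, mul_mul_mul_comm, hx, hy])).1 hxy
    exact (hp.mem_or_mem _ _ this).imp (hmem s (hS s hs) x x' hx).2 (hmem t (hS t ht) y y' hy).2

/-- The Zariski coverings are the finite families of localizations whose images contain all
primes. -/
lemma mem_zariski_iff {T : Presieve X} :
    T ∈ zariski V X ↔ T.uncurry.Finite ∧ (∀ ⦃U : V.WAlgᵒᵖ⦄ (a : U ⟶ X), T a → localizations V a) ∧
      ∀ p, X.unop.IsPrimeIdeal p → ∃ (U : V.WAlgᵒᵖ) (a : U ⟶ X), T a ∧ PrimeIn p a := by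
  constructor
  · rintro ⟨n, f, A, a, ha, hf, rfl⟩
    refine ⟨?_, ?_, fun p hp => ?_⟩
    · rw [Presieve.uncurry_ofArrows]
      exact Set.finite_range _
    · rintro _ _ ⟨i⟩
      exact ⟨_, Submonoid.powers_fg _, ha i⟩
    · obtain ⟨i, hi⟩ : ∃ i, f i ∉ p := by
        by_contra! h
        have h1 : (1 : X.unop) ∈ X.unop.idealSpan (Set.range f) := hf ▸ Set.mem_univ _
        exact hp.one_notMem (idealSpan_subset hp.toIsIdeal (Set.range_subset_iff.2 h) h1)
      refine ⟨_, _, .mk i, .of_disjoint hp (ha i) ?_⟩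
      rintro _ ⟨n, rfl⟩
      exact pow_mem (S := hp.compl) hi n
  · rintro ⟨hfin, hl, hp⟩
    obtain ⟨n, g, -, hg⟩ := hfin.fin_param
    have hT : ∀ i, T (g i).2 := fun i => by
      have : g i ∈ T.uncurry := hg ▸ Set.mem_range_self i
      exact this
    have hloc : ∀ i, ∃ r : X.unop,
        (Submonoid.powers r).IsLocalizationMap (monoidHom (g i).2.unop) :=
      fun i => by
        obtain ⟨S, hS, h⟩ := hl _ (hT i)
        exact h.exists_powers hS
    choose f hf using hloc
    refine ⟨n, f, fun i => (g i).1, fun i => (g i).2, hf,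
      (idealSpan_isIdeal _ _).eq_univ
        ((idealSpan_isIdeal _ _).one_mem_of_forall_prime fun p hpp => ?_), ?_⟩
    · obtain ⟨U, a, ha, h⟩ := hp p hpp
      have : (⟨U, a⟩ : Σ U, U ⟶ X) ∈ Set.range g := hg ▸ ha
      obtain ⟨i, hi⟩ := this
      refine ⟨f i, subset_idealSpan _ _ ⟨i, rfl⟩, fun hfi => ?_⟩
      have h' : PrimeIn p (g i).2 := by rw [hi]; exact h
      exact h'.notMem (hf i) (Submonoid.mem_powers _) hfi
    · funext U
      ext a
      constructor
      · intro ha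
        have : (⟨U, a⟩ : Σ U, U ⟶ X) ∈ Set.range g := hg ▸ ha
        obtain ⟨i, hi⟩ := this
        have : Presieve.ofArrows (fun i => (g i).1) (fun i => (g i).2) (g i).2 := .mk i
        rwa [hi] at this
      · rintro ⟨i⟩
        exact hT i

/-- If the base change of `T` to a localization `a` containing `p` is a Zariski covering, then `p`
is contained in a member of `T`. -/
lemma exists_primeIn_of_isBaseChange {p : Set X.unop} (hp : X.unop.IsPrimeIdeal p) {a : U ⟶ X}
    (ha : localizations V a) (h : PrimeIn p a) {T : Presieve X} {T' : Presieve U}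
    (hT' : T' ∈ zariski V U) (hb : CohSite.IsBaseChange a T T') :
    ∃ (W : V.WAlgᵒᵖ) (b : W ⟶ X), T b ∧ PrimeIn p b := by
  obtain ⟨q, hq, rfl⟩ := h.exists_extension hp ha
  obtain ⟨P, c, hc, hqc⟩ := (mem_zariski_iff.1 hT').2.2 q hq
  obtain ⟨W, b, d, hb, hP⟩ := hb.2 c hc
  refine ⟨W, b, hb, fun r hr hu => hqc _ hr ?_⟩
  have hd := isUnit_hom d.unop hu
  rwa [← monoidHom_comp, ← unop_comp, ← hP.w, unop_comp, monoidHom_comp] at hd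

end PrimeIn

/-! ### Descent for the Zariski topology -/

section Descent

/-- The ideal {c | c x = c y} meets the complement of every prime: where p lies in the image of a
member, equality there gives such a c among the elements inverted. -/
lemma eq_of_zariski_local {X : V.WAlgᵒᵖ} {T : Presieve X} (hT : T ∈ zariski V X) {x y : X.unop}
    (h : ∀ ⦃U : V.WAlgᵒᵖ⦄ (a : U ⟶ X), T a → monoidHom a.unop x = monoidHom a.unop y) : x = y := by
  have hI : X.unop.IsIdeal {c | c * x = c * y} :=
    ⟨fun φ c hc => by
        have hc' : ∀ i, c i * x = c i * y := hc
        rw [Set.mem_ofPred_eq, op_mul, op_mul]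
        simp only [hc'],
      fun r c hc => by
        have hc' : c * x = c * y := hc
        rw [Set.mem_ofPred_eq, mul_assoc, hc', mul_assoc]⟩
  obtain ⟨-, hl, hp⟩ := mem_zariski_iff.1 hT
  have h1 : (1 : X.unop) * x = 1 * y := hI.one_mem_of_forall_prime fun p hpp => by
    obtain ⟨U, a, ha, hpa⟩ := hp p hpp
    obtain ⟨S, -, hS⟩ := hl a ha
    obtain ⟨c, hc, e⟩ := hS.exists_mem_of_eq (h a ha)
    exact ⟨c, e, hpa.notMem hS hc⟩
  simpa using h1

/-- The c for which the family c·w comes from X form an ideal. Near a prime in the image of the j-th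
member, the denominator of w j, suitably enlarged, is such a c. -/
lemma exists_zariski_glue {X : V.WAlgᵒᵖ} {n : ℕ} {A : Fin n → V.WAlgᵒᵖ} {a : ∀ i, A i ⟶ X}
    (hT : Presieve.ofArrows A a ∈ zariski V X) (w : ∀ i, (A i).unop)
    (hw : ∀ i j (P : V.WAlgᵒᵖ) (p : P ⟶ A i) (q : P ⟶ A j), p ≫ a i = q ≫ a j →
      monoidHom p.unop (w i) = monoidHom q.unop (w j)) :
    ∃ x : X.unop, ∀ i, monoidHom (a i).unop x = w i := by
  obtain ⟨-, hl, hp⟩ := mem_zariski_iff.1 hT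
  have hI : X.unop.IsIdeal
      {c | ∃ x, ∀ i, monoidHom (a i).unop x = monoidHom (a i).unop c * w i} := by
    refine ⟨fun φ c hc => ?_, fun r c ⟨x, hx⟩ => ⟨r * x, fun i => ?_⟩⟩
    · choose x hx using hc
      refine ⟨funMap (L := V.lang) φ x, fun i => ?_⟩
      rw [monoidHom_op, monoidHom_op, op_mul]
      simp only [hx]
    · rw [map_mul, hx, map_mul, mul_assoc]
  obtain ⟨x, hx⟩ := hI.one_mem_of_forall_prime fun p hpp => by
    obtain ⟨_, _, ⟨j⟩, hpa⟩ := hp p hpp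
    obtain ⟨S, -, hS⟩ := hl (a j) (.mk j)
    obtain ⟨s, hs, y, hy⟩ := hS.surj_mem (w j)
    -- On the intersection with the j-th member, y and s·w i agree; this intersection is a
    -- localization of A i at the image of S, so they agree on A i after multiplication by some c in
    -- S.
    have key : ∀ i, ∃ c ∈ S, monoidHom (a i).unop (c * y) =
        monoidHom (a i).unop (c * s) * w i := fun i => by
      obtain ⟨q, hP⟩ := exists_isPullback_toLoc (a i) hS
      have hL := toLoc_isLocalizationMap (A i).unop (S.map (monoidHom (a i).unop))
      have hc : ∀ z, monoidHom q.unop (monoidHom (a j).unop z) =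
          monoidHom ((A i).unop.toLoc (S.map (monoidHom (a i).unop))) (monoidHom (a i).unop z) :=
        fun z => by
          rw [← monoidHom_comp, ← unop_comp, ← hP.w, unop_comp, monoidHom_comp]
          rfl
      have hwij := hw i j _ _ q hP.w
      have e : monoidHom ((A i).unop.toLoc (S.map (monoidHom (a i).unop)))
          (monoidHom (a i).unop y) =
          monoidHom ((A i).unop.toLoc (S.map (monoidHom (a i).unop)))
            (monoidHom (a i).unop s * w i) := by
        rw [map_mul, ← hc, ← hc, ← hy, map_mul, ← hwij, mul_comm]
        rfl
      obtain ⟨_, ⟨c, hcS, rfl⟩, e'⟩ := hL.exists_mem_of_eq e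
      refine ⟨c, hcS, ?_⟩
      rw [map_mul, e', map_mul, mul_assoc]
    choose c hcS hc using key
    -- The product of the finitely many multipliers works for every i at once.
    have hcS' : ∏ i, c i ∈ S := S.prod_mem fun i _ => hcS i
    refine ⟨(∏ i, c i) * s, ⟨(∏ i, c i) * y, fun i => ?_⟩, hpa.notMem hS (S.mul_mem hcS' hs)⟩
    rw [← Finset.prod_erase_mul _ _ (Finset.mem_univ i), mul_assoc, mul_assoc, map_mul, hc,
      map_mul _ _ (c i * s), mul_assoc]
  exact ⟨x, fun i => by rw [hx, map_one, one_mul]⟩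

/-- A morphism X ⟶ Z is a homomorphism into X, so gluing is done element by element; uniqueness of
the glued elements makes the result a homomorphism. -/
lemma zariski_isSheafFor {X : V.WAlgᵒᵖ} {T : Presieve X} (hT : T ∈ zariski V X) (Z : V.WAlgᵒᵖ) :
    Presieve.IsSheafFor (yoneda.obj Z) T := by
  obtain ⟨n, f, A, a, -, -, rfl⟩ := id hT
  rw [Presieve.isSheafFor_arrows_iff]
  intro w hw
  have sep : ∀ {x y : X.unop}, (∀ i, monoidHom (a i).unop x = monoidHom (a i).unop y) → x = y := by
    refine fun h => eq_of_zariski_local hT ?_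
    rintro _ _ ⟨i⟩
    exact h i
  have key : ∀ z : Z.unop, ∃ x : X.unop, ∀ i, monoidHom (a i).unop x = monoidHom (w i).unop z :=
    fun z => exists_zariski_glue hT _ fun i j P p q hpq => by
      rw [← monoidHom_comp, ← monoidHom_comp, ← unop_comp, ← unop_comp]
      rw [show p ≫ w i = q ≫ w j from hw i j P p q hpq]
  choose g hg using key
  let g' : Z.unop ⟶ X.unop := ofMonoidHom
    { toFun := g
      map_one' := sep fun i => by rw [hg, map_one, map_one]
      map_mul' := fun x y => sep fun i => by rw [hg, map_mul, map_mul, hg, hg] }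
    fun φ x => sep fun i => by
      rw [monoidHom_op]
      simp only [MonoidHom.coe_mk, OneHom.coe_mk, hg, monoidHom_op]
  refine ⟨g'.op, fun i => Quiver.Hom.unop_inj (hom_ext fun z => hg z i), fun t ht =>
    Quiver.Hom.unop_inj (hom_ext fun z => sep fun i => ?_)⟩
  refine Eq.trans ?_ (hg z i).symm
  rw [← ht i]
  rfl

end Descent

/-- The Zariski topology is a coherent topology. -/
lemma zariski_isCoherentTopology (V : AlgType.{u}) :
    CohSite.IsCoherentTopology (localizations V) (zariski V) where
  finite X S hS := (mem_zariski_iff.1 hS).1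
  mem X S hS := (mem_zariski_iff.1 hS).2.1
  descent X S hS := zariski_isSheafFor hS
  id_mem X := by
    refine mem_zariski_iff.2 ⟨by simp, ?_, fun p hp => ⟨_, 𝟙 X, ⟨⟩, ?_⟩⟩
    · rintro _ _ ⟨⟩
      exact localizations_id X
    · refine .of_disjoint hp (isLocalizationMap_id X.unop) ?_
      rintro _ ⟨n, rfl⟩
      simpa using hp.one_notMem
  superset X S T hST hS := by
    refine mem_zariski_iff.2 ⟨T.finite, T.mem, fun p hp => ?_⟩
    obtain ⟨U, a, ha, h⟩ := (mem_zariski_iff.1 hS).2.2 p hp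
    exact ⟨U, a, hST _ _ ha, h⟩
  baseChange {X Y} f S T hS hT hST := by
    obtain ⟨-, hl, hp⟩ := mem_zariski_iff.1 hS
    refine mem_zariski_iff.2 ⟨hT, fun P p hp => ?_, fun m hm => ?_⟩
    · obtain ⟨U, a, q, ha, h⟩ := hST.2 p hp
      exact localizations_of_isPullback h (hl a ha)
    · obtain ⟨U, a, ha, hma⟩ := hp _ (hm.comap f.unop)
      obtain ⟨P, p, q, h, hT⟩ := hST.1 a ha
      exact ⟨P, p, hT, .of_isPullback h hm (hl a ha) hma⟩
  isLocal X S T hS h := by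
    refine mem_zariski_iff.2 ⟨T.finite, T.mem, fun p hp => ?_⟩
    obtain ⟨U, a, ha, hpa⟩ := (mem_zariski_iff.1 hS).2.2 p hp
    obtain ⟨T', hT', hb⟩ := h a ha
    exact exists_primeIn_of_isBaseChange hp (S.mem a ha) hpa hT' hb

end AlgType.WAlg

namespace AlgType.WAlg

variable {V : AlgType.{u}}

/-! ### The points of the Zariski spectrum given by prime ideals -/

/-- A prime in the images of two localizations is in the image of their intersection. -/
lemma PrimeIn.comp_of_isPullback {X U W P : V.WAlgᵒᵖ} {a : U ⟶ X} {b : W ⟶ X} {p : P ⟶ U}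
    {q : P ⟶ W} (h : IsPullback p q a b) {m : Set X.unop} (hm : X.unop.IsPrimeIdeal m)
    (ha : localizations V a) (hb : localizations V b) (hma : PrimeIn m a) (hmb : PrimeIn m b) :
    PrimeIn m (p ≫ a) := by
  obtain ⟨n, hn, rfl⟩ := hma.exists_extension hm ha
  have := PrimeIn.of_isPullback h hn hb hmb
  exact fun r hr hu => this _ hr hu

/-- The point of the Zariski spectrum given by a prime ideal. -/
def primePoint {R : V.WAlg} {p : Set R} (hp : R.IsPrimeIdeal p) : spec (zariski V) R where
  val S := ∃ (U : V.WAlgᵒᵖ) (a : U ⟶ op R), S.arrows a ∧ PrimeIn (X := op R) p a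
  le_of_prec S T hST := fun ⟨U, a, ha, hpa⟩ => by
    obtain ⟨T', hT', hb⟩ := hST a ha
    exact exists_primeIn_of_isBaseChange (X := op R) hp (S.mem a ha) hpa hT' hb
  map_zero S hS := fun ⟨U, a, ha, _⟩ => by
    rw [hS] at ha
    exact ha
  map_one S hS := by
    refine ⟨_, 𝟙 _, hS ▸ ⟨⟩, .of_disjoint (X := op R) hp (isLocalizationMap_id R) ?_⟩
    rintro _ ⟨n, rfl⟩
    simpa using hp.one_notMem
  map_join S T K hK := by
    rw [hK]
    constructor
    · rintro ⟨U, a, ha | ha, h⟩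
      exacts [.inl ⟨U, a, ha, h⟩, .inr ⟨U, a, ha, h⟩]
    · rintro (⟨U, a, ha, h⟩ | ⟨U, a, ha, h⟩)
      exacts [⟨U, a, .inl ha, h⟩, ⟨U, a, .inr ha, h⟩]
  map_meet S T K hK := by
    constructor
    · rintro ⟨P, k, hk, h⟩
      obtain ⟨U, W, a, b, p, q, ha, hb, hP, rfl⟩ := hK.2 k hk
      exact ⟨⟨U, a, ha, h.of_comp⟩, ⟨W, b, hb, PrimeIn.of_comp (c := q) (hP.w ▸ h)⟩⟩
    · rintro ⟨⟨U, a, ha, hpa⟩, ⟨W, b, hb, hpb⟩⟩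
      obtain ⟨P, p, q, hP, hk⟩ := hK.1 a b ha hb
      exact ⟨P, _, hk, .comp_of_isPullback (X := op R) hP hp (S.mem a ha) (T.mem b hb) hpa hpb⟩

/-! ### Sheaves of modules -/

section Modules

variable {R : V.WAlg} (M : R.RMod)

/-- The class of `m / 1` in `S⁻¹M`. -/
def toLocalizedSet (S : Submonoid R) (m : M) : LocalizedSet S M :=
  Quotient.mk _ (m, 1)

lemma subsingleton_localizedSet (S : Submonoid R) [Subsingleton M] :
    Subsingleton (LocalizedSet S M) := by
  refine ⟨fun x y => ?_⟩
  induction x using Quotient.inductionOn with | _ x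
  induction y using Quotient.inductionOn with | _ y
  exact Quotient.sound ⟨1, Subsingleton.elim _ _⟩

/-- The whole spectrum as an affine open subset. -/
def AffineOpen.whole (R : V.WAlg) : AffineOpen R :=
  ⟨Over.mk (𝟙 (op R)), localizations_id (op R)⟩

lemma isIn_whole {J : Precoverage V.WAlgᵒᵖ} (x : spec J R) : IsIn J x (AffineOpen.whole R) :=
  x.map_one _ rfl

/-- The germ of a global element. -/
def globalGerm (J : Precoverage V.WAlgᵒᵖ) (m : M) (x : spec J R) : ModStalk J M x :=
  germ J M x (.whole R) (isIn_whole x) (toLocalizedSet M _ m)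

/-- Comparing each germ over A with the global germ of the constant needs only the restriction to A,
not a common refinement of two affine open subsets. -/
lemma subsingleton_modStalk (zero : V.ops 0) {J : Precoverage V.WAlgᵒᵖ} (x : spec J R)
    [Subsingleton M] : Subsingleton (ModStalk J M x) := by
  have h0 : ∀ s : ModStalk J M x,
      s = globalGerm M J (funMap (L := V.lang) (n := 0) zero Fin.elim0) x := by
    rintro ⟨⟨A, hA⟩, m⟩
    have := subsingleton_localizedSet M A.inverted
    exact Quot.sound ⟨A, hA, 𝟙 _, Over.mkIdTerminal.from _, Subsingleton.elim _ _⟩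
  exact ⟨fun s t => (h0 s).trans (h0 t).symm⟩

lemma moduleSheafIsZero_of_subsingleton (zero : V.ops 0) (J : Precoverage V.WAlgᵒᵖ)
    [Subsingleton M] : ModuleSheafIsZero J M := fun _ =>
  ⟨fun _ _ => Subtype.ext (funext fun x =>
    (subsingleton_modStalk M zero (x : spec J R)).elim _ _)⟩

/-- The section of the sheaf of `M` given by an element of `M`. -/
def globalSection (J : Precoverage V.WAlgᵒᵖ) (m : M) :
    (moduleSheaf J M).presheaf.obj (op ⊤) :=
  ⟨fun x => globalGerm M J m x.1, fun x => ⟨⊤, x.2, 𝟙 _, .whole R, toLocalizedSet M _ m,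
    fun y => ⟨isIn_whole y.1, rfl⟩⟩⟩

lemma globalGerm_eq {J : Precoverage V.WAlgᵒᵖ} (h : ModuleSheafIsZero J M) (m m' : M)
    (x : spec J R) : globalGerm M J m x = globalGerm M J m' x := by
  have := (h ⊤).elim (globalSection M J m) (globalSection M J m')
  exact congrFun (congrArg Subtype.val this) ⟨x, trivial⟩

variable {M}

lemma inverted_le_compl {p : Set R} {hp : R.IsPrimeIdeal p} {A : AffineOpen R}
    (h : IsIn (zariski V) (primePoint hp) A) : A.inverted ≤ hp.compl := by
  obtain ⟨_, _, ⟨⟩, h⟩ := h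
  exact fun r hr hrp => h r hrp hr

variable (M) in
/-- The map from the stalk at a prime to the localization at this prime. -/
def stalkToLocalizedSet {p : Set R} (hp : R.IsPrimeIdeal p) :
    ModStalk (zariski V) M (primePoint hp) → LocalizedSet hp.compl M :=
  Quot.lift (fun s => LocalizedSet.map (inverted_le_compl s.1.2) M s.2) <| by
    rintro ⟨⟨A, hA⟩, s⟩ ⟨⟨B, hB⟩, t⟩ ⟨C, hC, g, h, e⟩
    have e' := congrArg (LocalizedSet.map (inverted_le_compl hC) M) e
    induction s using Quotient.inductionOn with | _ s
    induction t using Quotient.inductionOn with | _ t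
    exact e'

/-- The germs are compared in the localization of M at p, where equality of m/1 and m'/1 has this
meaning. -/
lemma exists_smul_eq_of_globalGerm_eq {p : Set R} (hp : R.IsPrimeIdeal p) {m m' : M}
    (h : globalGerm M (zariski V) m (primePoint hp) = globalGerm M (zariski V) m' (primePoint hp)) :
    ∃ c ∉ p, c • m = c • m' := by
  have h' : toLocalizedSet M hp.compl m = toLocalizedSet M hp.compl m' :=
    congrArg (stalkToLocalizedSet M hp) h
  obtain ⟨c, hc⟩ := Quotient.exact h'
  exact ⟨c, c.2, by simpa using hc⟩

/-- The Zariski topology detects whether a module is zero. -/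
lemma zariski_moduleSheafIsZero_iff (zero : V.ops 0) (M : R.RMod) :
    ModuleSheafIsZero (zariski V) M ↔ Subsingleton M := by
  refine ⟨fun h => ⟨fun m m' => ?_⟩, fun _ => moduleSheafIsZero_of_subsingleton M zero _⟩
  have hI : R.IsIdeal {c | c • m = c • m'} :=
    ⟨fun φ c hc => by
        have hc' : ∀ i, c i • m = c i • m' := hc
        rw [Set.mem_ofPred_eq, M.op_smul, M.op_smul]
        simp only [hc'],
      fun r c hc => by
        have hc' : c • m = c • m' := hc
        rw [Set.mem_ofPred_eq, mul_smul, hc', mul_smul]⟩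
  have h1 : (1 : R) • m = (1 : R) • m' := hI.one_mem_of_forall_prime fun p hp => by
    obtain ⟨c, hc, e⟩ := exists_smul_eq_of_globalGerm_eq hp (globalGerm_eq M h m m' (primePoint hp))
    exact ⟨c, e, hc⟩
  simpa using h1

end Modules

end AlgType.WAlg

namespace AlgType

variable {V : AlgType.{u}}

/-! ### The entropic law -/

/-- The pointwise operators on functions with values in a `V`-algebra. -/
@[reducible] def funStructure (ι : Type u) (B : V.Alg) : V.lang.Structure (ι → B) where
  funMap φ a i := funMap (L := V.lang) φ fun k => a k i
  RelMap r := r.elim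

/-- The algebra of functions with values in a `V`-algebra. -/
def funAlg (ι : Type u) (B : V.Alg) : V.Alg where
  carrier := ι → B
  str := funStructure ι B
  satisfies :=
    letI := funStructure ι B
    Satisfies.of_separating _ (B := fun _ : ι => B) (fun _ => B.str) (fun _ => B.satisfies)
      (fun i => ⟨fun a => a i, fun _ _ => rfl, fun r => r.elim⟩) fun _ _ h => funext h

/-- In a self-enhancing algebraic type, all operators commute with each other. -/
lemma IsSelfEnhancing.entropic (hV : V.IsSelfEnhancing) (B : V.Alg) {n m : ℕ} (φ : V.ops n)
    (ψ : V.ops m) (b : Fin n → Fin m → B) :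
    funMap (L := V.lang) φ (fun i => funMap (L := V.lang) ψ (b i)) =
      funMap (L := V.lang) ψ fun j => funMap (L := V.lang) φ fun i => b i j := by
  obtain ⟨H⟩ := hV
  -- In the algebra of functions B^m → B, the evaluations at the rows of b are homomorphisms to B.
  -- Self-enhancement makes φ of them a homomorphism; it is applied to ψ of the coordinate
  -- projections.
  let A : V.Alg := funAlg (ULift.{u} (Fin m) → B) B
  let ev : Fin n → (A →[V.lang] B) := fun i =>
    ⟨fun a => a fun j => b i j.down, fun _ _ => rfl, fun r => r.elim⟩
  let pr : Fin m → A := fun j f => f ⟨j⟩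
  have h := FirstOrder.Language.Hom.map_fun ((H.homStr A B).funMap φ ev) ψ pr
  rw [H.natural] at h
  refine h.trans (congrArg (funMap (L := V.lang) ψ) (funext fun j => ?_))
  exact H.natural A B φ ev (pr j)

namespace WAlg

/-! ### Extensions by an ideal of square zero -/

/-- The element of `R` given by a constant of `V`. -/
def const (R : V.WAlg) (zero : V.ops 0) : R := funMap (L := V.lang) (n := 0) zero Fin.elim0

lemma mul_const (R : V.WAlg) (zero : V.ops 0) (r : R) : r * R.const zero = R.const zero := by
  rw [const, R.mul_op]
  exact congrArg _ (funext fun i => i.elim0)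

lemma op_const (hV : V.IsSelfEnhancing) (R : V.WAlg) (zero : V.ops 0) {n : ℕ} (φ : V.ops n) :
    funMap (L := V.lang) φ (fun _ => R.const zero) = R.const zero := by
  refine (hV.entropic ⟨R.carrier, R.satisfies⟩ φ zero fun _ => Fin.elim0).trans ?_
  exact congrArg (funMap (L := V.lang) (n := 0) zero) (funext fun i => i.elim0)

lemma const_mem_of_isIdeal {R : V.WAlg} {I : Set R} (hI : R.IsIdeal I) (zero : V.ops 0) :
    R.const zero ∈ I :=
  hI.op_mem zero _ fun i => i.elim0

variable (R : V.WAlg)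

/-- The operators on `R × R`. -/
def pairOp {n : ℕ} (φ : V.ops n) (x : Fin n → R × R) : R × R :=
  (funMap (L := V.lang) φ fun i => (x i).1, funMap (L := V.lang) φ fun i => (x i).2)

/-- The action of an element of `R` on `R × R`. -/
def scalar (r : R) (x : R × R) : R × R := (r * x.1, r * x.2)

/-- The action of a multiple of the square zero element `(a, b) ↦ (0, a)` on `R × R`. -/
def shift (zero : V.ops 0) (r : R) (x : R × R) : R × R := (R.const zero, r * x.1)

/-- The endomorphisms of `R × R` generated under the operators by the elements of `R` and the shifts
by elements of `I`. -/
inductive InSqZero (zero : V.ops 0) (I : Set R) : (R × R → R × R) → Prop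
  | scalar (r : R) : InSqZero zero I (R.scalar r)
  | shift (r : R) (hr : r ∈ I) : InSqZero zero I (R.shift zero r)
  | op {n : ℕ} (φ : V.ops n) (e : Fin n → R × R → R × R) (he : ∀ i, InSqZero zero I (e i)) :
      InSqZero zero I fun x => R.pairOp φ fun i => e i x

variable {R} {zero : V.ops 0} {I : Set R}

lemma scalar_comp_scalar (r s : R) : R.scalar r ∘ R.scalar s = R.scalar (r * s) := by
  funext x
  simp [scalar, mul_assoc]

lemma scalar_comp_shift (r s : R) : R.scalar r ∘ R.shift zero s = R.shift zero (r * s) := by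
  funext x
  simp [scalar, shift, mul_assoc, mul_const]

lemma shift_comp_scalar (r s : R) : R.shift zero r ∘ R.scalar s = R.shift zero (r * s) := by
  funext x
  simp [scalar, shift, mul_assoc]

lemma shift_comp_shift (r s : R) :
    R.shift zero r ∘ R.shift zero s = fun _ => (R.const zero, R.const zero) := by
  funext x
  simp [shift, mul_const]

/-! ### Composition and commutativity of the endomorphisms -/

namespace InSqZero

lemma const : InSqZero R zero I fun _ => (R.const zero, R.const zero) := by
  have := InSqZero.op (R := R) (zero := zero) (I := I) zero (fun i => i.elim0) fun i => i.elim0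
  convert this using 2
  unfold pairOp WAlg.const
  congr! 2

lemma mono {I' : Set R} (h : I ⊆ I') {e : R × R → R × R} (he : InSqZero R zero I e) :
    InSqZero R zero I' e := by
  induction he with
  | scalar r => exact .scalar r
  | shift r hr => exact .shift r (h hr)
  | op φ e _ ih => exact .op φ e ih

/-- The endomorphisms are compatible with the operators. -/
lemma map_pairOp (hV : V.IsSelfEnhancing) {e : R × R → R × R} (he : InSqZero R zero I e) {n : ℕ}
    (φ : V.ops n) (x : Fin n → R × R) : e (R.pairOp φ x) = R.pairOp φ fun i => e (x i) := by
  induction he with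
  | scalar r => simp [WAlg.scalar, pairOp, R.mul_op]
  | shift r hr => simp [WAlg.shift, pairOp, R.mul_op, op_const hV]
  | op ψ e _ ih =>
    simp only [ih]
    have := fun b : Fin _ → Fin n → R => hV.entropic ⟨R.carrier, R.satisfies⟩ ψ φ b
    exact Prod.ext (this fun i j => (e i (x j)).1) (this fun i j => (e i (x j)).2)

/-- Since e respects the operators, induction on f reduces to generators. Two ideals are allowed
because `scalar_comp` takes f from the larger extension. -/
lemma comp_mem_of_generators (hV : V.IsSelfEnhancing) {I' : Set R} {e f : R × R → R × R}
    (he : InSqZero R zero I e) (hf : InSqZero R zero I' f)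
    (h1 : ∀ r, InSqZero R zero I (e ∘ R.scalar r))
    (h2 : ∀ r ∈ I', InSqZero R zero I (e ∘ R.shift zero r)) : InSqZero R zero I (e ∘ f) := by
  induction hf with
  | scalar r => exact h1 r
  | shift r hr => exact h2 r hr
  | op φ f _ ih =>
    convert InSqZero.op φ (fun i => e ∘ f i) ih using 2 with x
    exact he.map_pairOp hV φ _

lemma comp (hV : V.IsSelfEnhancing) (hI : R.IsIdeal I) {e f : R × R → R × R}
    (he : InSqZero R zero I e) (hf : InSqZero R zero I f) : InSqZero R zero I (e ∘ f) := by
  induction he with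
  | scalar r =>
    refine (InSqZero.scalar r).comp_mem_of_generators hV hf (fun s => ?_) fun s hs => ?_
    · exact scalar_comp_scalar r s ▸ .scalar _
    · exact scalar_comp_shift r s ▸ .shift _ (hI.mul_mem r s hs)
  | shift r hr =>
    refine (InSqZero.shift r hr).comp_mem_of_generators hV hf (fun s => ?_) fun s hs => ?_
    · exact shift_comp_scalar (zero := zero) r s ▸ .shift _ (hI.mul_mem_right s hr)
    · exact shift_comp_shift (zero := zero) r s ▸ .const
  | op φ e _ ih => exact .op φ (fun i => e i ∘ f) ih

lemma comm_of_generators (hV : V.IsSelfEnhancing) {e f : R × R → R × R}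
    (he : InSqZero R zero I e) (hf : InSqZero R zero I f)
    (h1 : ∀ r, e ∘ R.scalar r = R.scalar r ∘ e)
    (h2 : ∀ r, e ∘ R.shift zero r = R.shift zero r ∘ e) : e ∘ f = f ∘ e := by
  induction hf with
  | scalar r => exact h1 r
  | shift r hr => exact h2 r
  | op φ f _ ih =>
    funext x
    refine (he.map_pairOp hV φ _).trans (congrArg (R.pairOp φ) (funext fun i => ?_))
    exact congrFun (ih i) x

lemma comm (hV : V.IsSelfEnhancing) {e f : R × R → R × R}
    (he : InSqZero R zero I e) (hf : InSqZero R zero I f) : e ∘ f = f ∘ e := by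
  induction he with
  | scalar r =>
    refine (InSqZero.scalar r).comm_of_generators hV hf (fun s => ?_) fun s => ?_
    · rw [scalar_comp_scalar, scalar_comp_scalar, mul_comm]
    · rw [scalar_comp_shift, shift_comp_scalar, mul_comm]
  | shift r hr =>
    refine (InSqZero.shift r hr).comm_of_generators hV hf (fun s => ?_) fun s => ?_
    · rw [scalar_comp_shift, shift_comp_scalar, mul_comm]
    · rw [shift_comp_shift, shift_comp_shift]
  | op φ e _ ih =>
    funext x
    refine Eq.trans (congrArg (R.pairOp φ) (funext fun i => congrFun (ih i) x)) ?_
    exact (hf.map_pairOp hV φ _).symm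

/-- This is the inclusion r R[ε] ⊆ R[Iε] for r in I, by which both extensions agree once r is
inverted. -/
lemma scalar_comp (hV : V.IsSelfEnhancing) (hI : R.IsIdeal I) {r : R} (hr : r ∈ I)
    {f : R × R → R × R} (hf : InSqZero R zero Set.univ f) :
    InSqZero R zero I (R.scalar r ∘ f) := by
  refine (InSqZero.scalar r).comp_mem_of_generators hV hf (fun s => ?_) fun s _ => ?_
  · exact scalar_comp_scalar r s ▸ .scalar _
  · exact scalar_comp_shift r s ▸ .shift _ (hI.mul_mem_right s hr)

/-- The coefficient of the square zero element lies in the ideal. -/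
lemma coeff_mem (hI : R.IsIdeal I) {e : R × R → R × R} (he : InSqZero R zero I e) :
    (e (1, R.const zero)).2 ∈ I := by
  induction he with
  | scalar r =>
    change r * R.const zero ∈ I
    rw [mul_const]
    exact const_mem_of_isIdeal hI zero
  | shift r hr => exact hI.mul_mem_right 1 hr
  | op φ e _ ih => exact hI.op_mem φ _ ih

end InSqZero

instance sqZeroStructure (R : V.WAlg) (zero : V.ops 0) (I : Set R) :
    V.lang.Structure {e // InSqZero R zero I e} where
  funMap φ e := ⟨fun x => R.pairOp φ fun i => (e i).1 x, .op φ _ fun i => (e i).2⟩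
  RelMap r := r.elim

/-- The two coordinates of the values at all points of R × R separate endomorphisms and respect the
pointwise operators. -/
lemma sqZero_satisfies (R : V.WAlg) (zero : V.ops 0) (I : Set R) :
    V.Satisfies (sqZeroStructure R zero I) := by
  refine Satisfies.of_separating _ (ι := (R × R) × Bool) (B := fun _ => R) (fun _ => R.str)
    (fun _ => R.satisfies)
    (fun i => ⟨fun e => bif i.2 then (e.1 i.1).1 else (e.1 i.1).2, ?_, fun r => r.elim⟩) ?_
  · intro n φ e
    obtain ⟨x, _ | _⟩ := i <;> rfl
  · exact fun e f h => Subtype.ext (funext fun x => Prod.ext (h (x, true)) (h (x, false)))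

/-- The extension of `R` by an ideal `I`, with square zero, as an algebra of endomorphisms
of `R × R`. -/
def sqZero (hV : V.IsSelfEnhancing) (zero : V.ops 0) {R : V.WAlg} {I : Set R} (hI : R.IsIdeal I) :
    V.WAlg where
  carrier := {e // InSqZero R zero I e}
  str := sqZeroStructure R zero I
  satisfies := sqZero_satisfies R zero I
  monoid :=
    { mul := fun e f => ⟨e.1 ∘ f.1, e.2.comp hV hI f.2⟩
      mul_assoc := fun _ _ _ => rfl
      one := ⟨id, by
        convert InSqZero.scalar (R := R) (zero := zero) (I := I) 1
        funext x
        simp [scalar]⟩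
      one_mul := fun _ => rfl
      mul_one := fun _ => rfl
      mul_comm := fun e f => Subtype.ext (e.2.comm hV f.2) }
  mul_op φ e f := Subtype.ext (funext fun _ => e.2.map_pairOp hV φ _)

/-! ### Comparison of the extension by `I` with the extension by `R` -/

section sqZero

variable (hV : V.IsSelfEnhancing) (zero : V.ops 0) {R : V.WAlg} {I : Set R} (hI : R.IsIdeal I)

lemma isIdeal_univ (R : V.WAlg) : R.IsIdeal Set.univ := ⟨fun _ _ _ => trivial, fun _ _ _ => trivial⟩

/-- The inclusion of `R` into its square zero extension. -/
def toSqZero : R ⟶ sqZero hV zero hI :=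
  ofMonoidHom (S := sqZero hV zero hI)
    { toFun := fun r => ⟨R.scalar r, .scalar r⟩
      map_one' := Subtype.ext (funext fun x => by simp [scalar]; rfl)
      map_mul' := fun r s => Subtype.ext (scalar_comp_scalar r s).symm }
    fun φ r => Subtype.ext (funext fun x => Prod.ext (R.op_mul φ x.1 r) (R.op_mul φ x.2 r))

/-- The inclusion of the extension by `I` into the extension by `R`. -/
def sqZeroIncl : sqZero hV zero hI ⟶ sqZero hV zero (isIdeal_univ R) :=
  ofMonoidHom (R := sqZero hV zero hI) (S := sqZero hV zero (isIdeal_univ R))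
    { toFun := fun e => ⟨e.1, e.2.mono (Set.subset_univ I)⟩
      map_one' := rfl
      map_mul' := fun _ _ => rfl }
    fun _ _ => rfl

variable {hV zero hI} {B : V.WAlg}

/-- Multiplication by an element of `I` maps the extension by `R` into the extension by `I`. -/
def mulSqZero {r : R} (hr : r ∈ I) (e : sqZero hV zero (isIdeal_univ R)) : sqZero hV zero hI :=
  ⟨R.scalar r ∘ e.1, InSqZero.scalar_comp hV hI hr e.2⟩

lemma sqZeroIncl_mulSqZero {r : R} (hr : r ∈ I) (e : sqZero hV zero (isIdeal_univ R)) :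
    monoidHom (sqZeroIncl hV zero hI) (mulSqZero hr e) =
      monoidHom (sqZeroIncl hV zero hI) (monoidHom (toSqZero hV zero hI) r) * e := rfl

/-- The element r e lies in the smaller extension, where g and g' agree, and the value of r can be
cancelled. -/
lemma sqZero_hom_ext {r : R} (hr : r ∈ I) {g g' : sqZero hV zero (isIdeal_univ R) ⟶ B}
    (h : sqZeroIncl hV zero hI ≫ g = sqZeroIncl hV zero hI ≫ g')
    (hu : IsUnit (monoidHom (sqZeroIncl hV zero hI ≫ g) (monoidHom (toSqZero hV zero hI) r))) :
    g = g' := by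
  refine hom_ext fun e => ?_
  have h' : ∀ x, monoidHom g (monoidHom (sqZeroIncl hV zero hI) x) =
      monoidHom g' (monoidHom (sqZeroIncl hV zero hI) x) := fun x => by
    rw [← monoidHom_comp, h, monoidHom_comp]
  rw [← hu.mul_right_inj, monoidHom_comp, ← map_mul, ← sqZeroIncl_mulSqZero hr, h', h',
    sqZeroIncl_mulSqZero hr, map_mul]

/-- The extension has to be e ↦ β(r e)/β(r); it is multiplicative because (r e)(r f) = r (r e f). -/
lemma exists_sqZero_extension {r : R} (hr : r ∈ I) (β : sqZero hV zero hI ⟶ B)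
    (hu : IsUnit (monoidHom β (monoidHom (toSqZero hV zero hI) r))) :
    ∃ g : sqZero hV zero (isIdeal_univ R) ⟶ B, sqZeroIncl hV zero hI ≫ g = β := by
  obtain ⟨u, hu⟩ := hu
  have hmul : ∀ e f : sqZero hV zero (isIdeal_univ R),
      mulSqZero (hI := hI) hr e * mulSqZero hr f =
        monoidHom (toSqZero hV zero hI) r * mulSqZero hr (e * f) := fun e f => by
    refine Subtype.ext ?_
    change (R.scalar r ∘ e.1) ∘ (R.scalar r ∘ f.1) = R.scalar r ∘ R.scalar r ∘ (e.1 ∘ f.1)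
    have := e.2.comm hV (InSqZero.scalar r)
    rw [Function.comp_assoc, ← Function.comp_assoc e.1, this]
    rfl
  refine ⟨ofMonoidHom
    { toFun := fun e => ↑u⁻¹ * monoidHom β (mulSqZero hr e)
      map_one' := ?_
      map_mul' := fun e f => ?_ } fun φ e => ?_, hom_ext fun e => ?_⟩
  · rw [Units.inv_mul_eq_iff_eq_mul, mul_one, hu]
    rfl
  · rw [mul_mul_mul_comm, ← map_mul, hmul, map_mul, ← hu, mul_assoc, Units.inv_mul_cancel_left]
  · have : mulSqZero (hI := hI) hr (funMap (L := V.lang) φ e) =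
        funMap (L := V.lang) φ fun i => mulSqZero hr (e i) :=
      Subtype.ext (funext fun _ => (InSqZero.scalar (zero := zero) (I := I) r).map_pairOp hV φ _)
    simp only [MonoidHom.coe_mk, OneHom.coe_mk]
    rw [this, monoidHom_op, B.mul_op]
  · change ↑u⁻¹ * monoidHom β (monoidHom (toSqZero hV zero hI) r * e) = _
    rw [map_mul, ← hu, Units.inv_mul_cancel_left]

/-- If the inclusion of the extension by `I` into the extension by `R` has a right inverse, then `I`
is the unit ideal. -/
lemma one_mem_of_retraction {h : sqZero hV zero (isIdeal_univ R) ⟶ sqZero hV zero hI}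
    (hh : h ≫ sqZeroIncl hV zero hI = 𝟙 _) : (1 : R) ∈ I := by
  let t : sqZero hV zero (isIdeal_univ R) := ⟨R.shift zero 1, .shift 1 trivial⟩
  have ht : (monoidHom h t).1 = R.shift zero 1 :=
    congrArg Subtype.val (show monoidHom (h ≫ sqZeroIncl hV zero hI) t = t by rw [hh]; rfl)
  have := InSqZero.coeff_mem hI (monoidHom h t).2
  rw [ht] at this
  simpa [shift] using this

end sqZero

/-! ### Maximality of the Zariski topology -/

/-- Every coherent topology is contained in the Zariski topology. -/
lemma le_zariski (hV : V.IsSelfEnhancing) (zero : V.ops 0) {J : Precoverage V.WAlgᵒᵖ}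
    (hJ : CohSite.IsCoherentTopology (localizations V) J) : J ≤ zariski V := by
  intro X S hS
  refine mem_zariski_iff.2 ⟨hJ.finite X S hS, hJ.mem X S hS, fun p hp => ?_⟩
  by_contra! hne
  have hr : ∀ ⦃U : V.WAlgᵒᵖ⦄ (a : U ⟶ X), S a → ∃ r ∈ p, IsUnit (monoidHom a.unop r) := by
    intro U a ha
    simpa [PrimeIn] using hne U a ha
  have hI := hp.toIsIdeal
  let s := (toSqZero hV zero hI).op
  let ι := (sqZeroIncl hV zero hI).op
  -- T is the covering pulled back to R[pε], and T' below is T pulled back to R[ε].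
  obtain ⟨T, hTfin, hT⟩ := exists_isBaseChange s (hJ.finite X S hS) (hJ.mem X S hS)
  have hTJ := hJ.baseChange s S T hS hTfin hT
  obtain ⟨T', hTfin', hT'⟩ := exists_isBaseChange ι hTfin (hJ.mem _ T hTJ)
  have hTJ' := hJ.baseChange ι T T' hTJ hTfin' hT'
  have hunit : ∀ ⦃P : V.WAlgᵒᵖ⦄ (b : P ⟶ _), T b →
      ∃ r ∈ p, IsUnit (monoidHom b.unop (monoidHom (toSqZero hV zero hI) r)) := by
    intro P b hb
    obtain ⟨U, a, q, ha, hP⟩ := hT.2 b hb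
    obtain ⟨r, hrp, hu⟩ := hr a ha
    refine ⟨r, hrp, ?_⟩
    have hq := isUnit_hom q.unop hu
    rwa [← monoidHom_comp, ← unop_comp, ← hP.w, unop_comp, monoidHom_comp] at hq
  have hext : ∀ ⦃P : V.WAlgᵒᵖ⦄ (b : P ⟶ _), T b →
      ∃ g : sqZero hV zero (isIdeal_univ X.unop) ⟶ P.unop, sqZeroIncl hV zero hI ≫ g = b.unop := by
    intro P b hb
    obtain ⟨r, hrp, hu⟩ := hunit b hb
    exact exists_sqZero_extension hrp _ hu
  choose g hg using hext
  -- The local extensions agree on overlaps because an extension is unique where some r in p is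
  -- invertible.
  obtain ⟨h, hh, -⟩ := hJ.descent _ T hTJ (op (sqZero hV zero (isIdeal_univ X.unop)))
    (fun P b hb => (g b hb).op) fun P₁ P₂ Y g₁ g₂ b₁ b₂ hb₁ hb₂ e => by
      obtain ⟨r, hrp, hu⟩ := hunit b₁ hb₁
      change g₁ ≫ (g b₁ hb₁).op = g₂ ≫ (g b₂ hb₂).op
      refine Quiver.Hom.unop_inj (sqZero_hom_ext (hV := hV) (hI := hI) hrp ?_ ?_)
      · change sqZeroIncl hV zero hI ≫ g b₁ hb₁ ≫ g₁.unop =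
          sqZeroIncl hV zero hI ≫ g b₂ hb₂ ≫ g₂.unop
        rw [← Category.assoc, ← Category.assoc, hg, hg, ← unop_comp, e, unop_comp]
      · change IsUnit (monoidHom (sqZeroIncl hV zero hI ≫ g b₁ hb₁ ≫ g₁.unop) _)
        rw [← Category.assoc, hg, monoidHom_comp]
        exact isUnit_hom _ hu
  -- Separatedness for T' reduces this to its members, where uniqueness of extensions applies again.
  have hι : ι ≫ h = 𝟙 _ := by
    refine (hJ.descent _ T' hTJ' _).isSeparatedFor.ext fun P c hc => ?_
    obtain ⟨Q, b, d, hb, hP⟩ := hT'.2 c hc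
    obtain ⟨r, hrp, hu⟩ := hunit b hb
    have hbh : b ≫ h = (g b hb).op := hh b hb
    change c ≫ ι ≫ h = c ≫ 𝟙 _
    rw [← Category.assoc, hP.w, Category.assoc, hbh, Category.comp_id]
    have e : sqZeroIncl hV zero hI ≫ g b hb ≫ d.unop = sqZeroIncl hV zero hI ≫ c.unop := by
      rw [← Category.assoc, hg]
      exact congrArg Quiver.Hom.unop hP.w.symm
    refine Quiver.Hom.unop_inj (sqZero_hom_ext hrp e ?_)
    change IsUnit (monoidHom (sqZeroIncl hV zero hI ≫ g b hb ≫ d.unop) _)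
    rw [← Category.assoc, hg, monoidHom_comp]
    exact isUnit_hom _ hu
  exact hp.one_notMem (one_mem_of_retraction (h := h.unop) (congrArg Quiver.Hom.unop hι))

end WAlg

end AlgType

theorem theorem5p6 (V : AlgType.{u}) (hV : V.IsSelfEnhancing) (zero : V.ops 0) :
    IsGreatest
      {J : Precoverage V.WAlgᵒᵖ |
        CohSite.IsCoherentTopology (AlgType.WAlg.localizations V) J ∧
        ∀ (R : V.WAlg) (M : R.RMod),
          AlgType.WAlg.ModuleSheafIsZero J M ↔ Subsingleton M}
      (AlgType.WAlg.zariski V) :=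
  ⟨⟨AlgType.WAlg.zariski_isCoherentTopology V,
    fun _ M => AlgType.WAlg.zariski_moduleSheafIsZero_iff zero M⟩,
    fun _ hJ => AlgType.WAlg.le_zariski hV zero hJ.1⟩
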